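/- Let $V(x)=e^{1/2-x^2/4}$, $L=-\partial_x^2+\frac14(x^2-6)$, and let $$X_c=\{u\in H^1(\mathbb R)\cap L^2_1(\mathbb R):\ \langle V,u\rangle_{L^2}=0\}$$ (real-valued functions; $L^2_1$ is the space $L^2$ with the weight $(1+x^2)^{1/2}$), with the norm $\|u\|^2_{H^1\cap L^2_1}=\int_{\mathbb R}\bigl(u_x^2+\frac14x^2u^2+\frac12u^2\bigr)dx$ and the energy $$E_c(u)=\langle Lu,u\rangle=\int_{\mathbb R}\Bigl(u_x^2+\tfrac14(x^2-6)u^2\Bigr)dx .$$ Let $u_n(x)=(2^n n!\sqrt{2\pi})^{-1/2}H_n(x/\sqrt2)e^{-x^2/4}$, $n\ge0$, be the normalized Hermite functions ($Lu_n=(n-1)u_n$), and for $u\in X_c$ define $(f_n)_{n\ge1}$ by $i^nf_n=\sqrt n\,\langle u_{n+1},u\rangle_{L^2}$. Let $J$ be the Jacobi difference expression $$(Jf)_n=\sqrt{n(n+1)(n+2)}\,f_{n+1}+\sqrt{(n-1)n(n+1)}\,f_{n-1},\qquad n\ge1,$$ let $v$ be the solution of $Jv=0$ with $v_1=1$, let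 $W_n(v,f)=\sqrt{n(n+1)(n+2)}\,(v_nf_{n+1}-v_{n+1}f_n)$, and let $$\mathcal D(v)=\{f\in\ell^2(\mathbb N):\ Jf\in\ell^2(\mathbb N),\ \lim_{n\to\infty}W_n(v,f)=0\}.$$ Let $\partial_xL$ be the operator in $X_c$ whose domain consists of all $u\in X_c$ such that the distribution $\partial_xLu$ belongs to $X_c$ and $(f_n)\in\mathcal D(v)$. For every $u(0)\in X_c$ there is a unique solution $u\in C([0,\infty),X_c)$ with this initial value of the linearized log-KdV equation $u_t=\partial_xLu$, that is, a unique continuous $u:[0,\infty)\to X_c$ such that for every $t\ge0$ the function $\int_0^tu(s)\,ds$ belongs to the domain of $\partial_xL$ and $$u(t)=u(0)+\partial_xL\int_0^tu(s)\,ds .$$ This solution satisfies $E_c(u(t))=E_c(u(0))$ for all $t\ge0$. -/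

import Mathlib

open MeasureTheory Filter Topology Set
open scoped ContDiff

noncomputable section

namespace LogKdV

/-- Real-valued `L²(ℝ)`, as equivalence classes. -/
abbrev L2 : Type := Lp ℝ 2 (volume : Measure ℝ)

/-- `φ` is a test function: smooth with compact support. -/
def IsTest (φ : ℝ → ℝ) : Prop := ContDiff ℝ ∞ φ ∧ HasCompactSupport φ

/-- `g` is the weak (distributional) derivative of `u`. -/
def HasWeakDeriv (u g : ℝ → ℝ) : Prop :=
  ∀ φ : ℝ → ℝ, IsTest φ → ∫ x, u x * deriv φ x = - ∫ x, g x * φ x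

/-- `u ∈ H¹(ℝ)`. -/
def MemH1 (u : L2) : Prop := ∃ g : L2, HasWeakDeriv u g

open Classical in
/-- The weak derivative `u_x ∈ L²(ℝ)` of `u ∈ H¹(ℝ)` (and `0` if `u ∉ H¹(ℝ)`). -/
def weakDeriv (u : L2) : L2 := if h : MemH1 u then h.choose else 0

/-- `u ∈ L²₁(ℝ)`: square integrable with the weight `(1 + x²)^{1/2}`. -/
def MemL21 (u : L2) : Prop := MemLp (fun x : ℝ => Real.sqrt (1 + x ^ 2) * u x) 2 volume

/-- The Gaussian solitary wave `V(x) = e^{1/2 - x²/4}`. -/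
def V (x : ℝ) : ℝ := Real.exp (1 / 2 - x ^ 2 / 4)

/-- The constrained energy space `X_c = {u ∈ H¹ ∩ L²₁ : ⟨V, u⟩ = 0}`. -/
def Xc : Set L2 := {u | MemH1 u ∧ MemL21 u ∧ ∫ x, V x * u x = 0}

/-- The squared norm `∫ (u_x² + x² u² / 4 + u² / 2) dx` of `H¹ ∩ L²₁`. -/
def normSqX (u : L2) : ℝ :=
  ∫ x, ((weakDeriv u x) ^ 2 + 1 / 4 * x ^ 2 * (u x) ^ 2 + 1 / 2 * (u x) ^ 2)

/-- The quadratic form `E_c(u) = ⟨L u, u⟩` of `L = -∂ₓ² + (x² - 6)/4` on its form domain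
`H¹ ∩ L²₁`. -/
def Ec (u : L2) : ℝ := ∫ x, ((weakDeriv u x) ^ 2 + 1 / 4 * (x ^ 2 - 6) * (u x) ^ 2)

/-- The differential expression `L = -∂ₓ² + (x² - 6)/4` on smooth functions. -/
def schrodinger (ψ : ℝ → ℝ) (x : ℝ) : ℝ :=
  - iteratedDeriv 2 ψ x + 1 / 4 * (x ^ 2 - 6) * ψ x

/-- `w = ∂ₓ L u` in the sense of distributions. -/
def IsDxL (u w : L2) : Prop :=
  ∀ φ : ℝ → ℝ, IsTest φ → ∫ x, w x * φ x = - ∫ x, u x * schrodinger (deriv φ) x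

/-- The normalized Hermite functions
`u_n(x) = (2ⁿ n! √(2π))^{-1/2} H_n(x/√2) e^{-x²/4}`, with `L u_n = (n - 1) u_n`.
Mathlib's `Polynomial.hermite` is the probabilists' one, and `H_n(x/√2) = 2^{n/2} He_n(x)`. -/
def hermiteFun (n : ℕ) (x : ℝ) : ℝ :=
  Polynomial.aeval x (Polynomial.hermite n) * Real.exp (-(x ^ 2) / 4)
    / Real.sqrt (n.factorial * Real.sqrt (2 * Real.pi))

/-- The Hermite coefficient `c_n = ⟨u_n, u⟩`. -/
def hermiteCoeff (u : L2) (n : ℕ) : ℝ := ∫ x, hermiteFun n x * u x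

/-- The sequence `a_n = √n c_{n+1}`, `n ≥ 1`. All sequences below are indexed by `n ≥ 1`;
the entry at `0` plays no role (here it is `0`). -/
def aSeq (u : L2) (n : ℕ) : ℝ := Real.sqrt n * hermiteCoeff u (n + 1)

/-- The sequence `f` given by `a_n = iⁿ f_n`. -/
def fSeq (u : L2) (n : ℕ) : ℂ := (Complex.I ^ n)⁻¹ * (aSeq u n : ℂ)

/-- The off-diagonal Jacobi coefficient `√(n (n+1) (n+2))`. -/
def jacobiCoeff (n : ℕ) : ℝ := Real.sqrt ((n : ℝ) * (n + 1) * (n + 2))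

/-- The Jacobi difference expression
`(J f)_n = √(n(n+1)(n+2)) f_{n+1} + √((n-1)n(n+1)) f_{n-1}`, `n ≥ 1`. -/
def jacobi (f : ℕ → ℂ) : ℕ → ℂ
  | 0 => 0
  | n + 1 => (jacobiCoeff (n + 1) : ℂ) * f (n + 2) + (jacobiCoeff n : ℂ) * f n

/-- The discrete Wronskian `W_n(f, g) = √(n(n+1)(n+2)) (f_n g_{n+1} - f_{n+1} g_n)`. -/
def wronskian (f g : ℕ → ℂ) (n : ℕ) : ℂ :=
  (jacobiCoeff n : ℂ) * (f n * g (n + 1) - f (n + 1) * g n)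

/-- The solution `v` of `J v = 0` with `v_1 = 1`:
`v_{n+1} = - (√(n-1) / √(n+2)) v_{n-1}`, so that `v_n = 0` for even `n`. -/
def vSeq : ℕ → ℝ
  | 0 => 0
  | 1 => 1
  | n + 2 => - (Real.sqrt n / Real.sqrt (n + 3)) * vSeq n

/-- The sequence `v` indeed solves `J v = 0`. -/
theorem jacobi_vSeq (n : ℕ) : jacobi (fun k => (vSeq k : ℂ)) n = 0 := by
  cases n with
  | zero => rfl
  | succ n =>
    have h : jacobiCoeff (n + 1) * vSeq (n + 2) + jacobiCoeff n * vSeq n = 0 := by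
      have h1 : jacobiCoeff (n + 1)
          = Real.sqrt (((n : ℝ) + 1) * (n + 2)) * Real.sqrt (n + 3) := by
        unfold jacobiCoeff
        rw [← Real.sqrt_mul (by positivity)]
        congr 1
        push_cast
        ring
      have h2 : jacobiCoeff n = Real.sqrt (((n : ℝ) + 1) * (n + 2)) * Real.sqrt n := by
        unfold jacobiCoeff
        rw [← Real.sqrt_mul (by positivity)]
        congr 1
        ring
      have h3 : Real.sqrt ((n : ℝ) + 3) ≠ 0 := by positivity
      rw [h1, h2, vSeq]
      field_simp
      ring
    simp only [jacobi]
    exact_mod_cast h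

/-- The domain of the self-adjoint Jacobi operator: `f ∈ ℓ²`, `J f ∈ ℓ²`, and the boundary
condition at infinity `W_∞(v, f) = 0`. -/
def jacobiDomain : Set (ℕ → ℂ) :=
  {f | Memℓp f 2 ∧ Memℓp (jacobi f) 2 ∧
    Tendsto (wronskian (fun k => (vSeq k : ℂ)) f) atTop (𝓝 0)}

/-- The graph of the operator `∂ₓ L` in `X_c`: `u, w ∈ X_c`, `w = ∂ₓ L u` in the sense of
distributions, and the Jacobi sequence of `u` lies in the domain of the self-adjoint Jacobi
operator. -/
def IsGen (u w : L2) : Prop := u ∈ Xc ∧ w ∈ Xc ∧ IsDxL u w ∧ fSeq u ∈ jacobiDomain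

/-- `u` is a (mild) solution in `X_c` for `t ≥ 0` of the linearized log-KdV equation
`u_t = ∂ₓ L u`, where `∂ₓ L` is the operator above: `u ∈ C([0,∞), X_c)`,
and `u(t) - u(0) = ∂ₓ L ∫₀ᵗ u(s) ds` for all `t ≥ 0`.
Values of `u` at negative times play no role. -/
structure IsSolution (u : ℝ → L2) : Prop where
  mem : ∀ t, 0 ≤ t → u t ∈ Xc
  continuous : ∀ s, 0 ≤ s → Tendsto (fun t => normSqX (u t - u s)) (𝓝[Ici 0] s) (𝓝 0)
  equation : ∀ t, 0 ≤ t → IsGen (∫ s in (0 : ℝ)..t, u s) (u t - u 0)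

end LogKdV

end

/-! Write u = ∑ c_n u_n in Hermite functions. The constraint says c_0 = 0, and E_c(u) = ∑ (n - 1)
c_n², so with a_n = √n c_{n+1} the energy is the squared ℓ² norm of a; only c_1, the kernel mode of
L, is invisible to it. The ladder relations turn u_t = ∂ₓLu into the triangular system a' = Aa, c_1'
= (√2/2) a_1, where A is the real skew-symmetric Jacobi matrix `skewJacobi`. It therefore suffices
that A, with the boundary condition in 𝒟(v), generates a group of isometries of ℓ²: isometry is
conservation of energy, and c_1 follows by integration (`exists_isSolution`).

The entries of A grow like n^{3/2}, and infinity is a limit circle: the formal solutions are square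
summable (`memℓp_homSol`), so a boundary condition is needed. By the discrete Green identity
(`sum_skewJacobi`) the defect of skew-symmetry is a boundary form at infinity. A Plücker identity
(`bdryForm_mul_bdryForm`) factors this form through two reference solutions and shows that it
vanishes on sequences satisfying the condition. Conversely, testing against unit vectors and against
the kernel solution recovers both the action of A and the condition. So the graph is its own
annihilator (`isSkewAdjoint_jacobiRel`), and Stone's theorem, proved by bounded Yosida
approximations, supplies the flow (`IsSkewAdjoint.exists_flow`).

For uniqueness, the difference z of the time integrals of two solutions satisfies z' = Az and z(0) =
0 in the classical sense, and ⟨z, Az⟩ = 0 keeps its norm constant (`IsSolution.eq`).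

The remaining work is the dictionary between functions and coefficients: completeness of the Hermite
functions, and descriptions of X_c, of the distributional ∂ₓL and of its domain in terms of c_n
(`mem_Xc_iff`, `isDxL_iff`, `isGen_iff`). -/

namespace LogKdV

/-! ### Skew-adjoint relations in a real Hilbert space and Stone's theorem -/

section SkewAdjoint

open scoped InnerProductSpace

variable {H : Type*} [NormedAddCommGroup H] [InnerProductSpace ℝ H]

/-- A linear relation `G` in a real inner product space is skew-adjoint if it is its own
annihilator for the form `⟪x, b⟫ + ⟪y, a⟫`. -/
def IsSkewAdjoint (G : Submodule ℝ (H × H)) : Prop :=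
  ∀ p : H × H, p ∈ G ↔ ∀ q ∈ G, ⟪p.1, q.2⟫_ℝ + ⟪p.2, q.1⟫_ℝ = 0

variable {G : Submodule ℝ (H × H)}

theorem IsSkewAdjoint.inner_add (hG : IsSkewAdjoint G) {p q : H × H} (hp : p ∈ G) (hq : q ∈ G) :
    ⟪p.1, q.2⟫_ℝ + ⟪p.2, q.1⟫_ℝ = 0 :=
  (hG p).1 hp q hq

theorem IsSkewAdjoint.inner_self (hG : IsSkewAdjoint G) {p : H × H} (hp : p ∈ G) :
    ⟪p.1, p.2⟫_ℝ = 0 := by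
  have h := hG.inner_add hp hp
  rw [real_inner_comm p.1 p.2] at h
  linarith

/-- Being its own annihilator makes the relation an intersection of kernels of continuous
functionals. -/
theorem IsSkewAdjoint.isClosed (hG : IsSkewAdjoint G) : IsClosed (G : Set (H × H)) := by
  have h : (G : Set (H × H)) = ⋂ q ∈ G, {p : H × H | ⟪p.1, q.2⟫_ℝ + ⟪p.2, q.1⟫_ℝ = 0} := by
    ext p
    simp only [SetLike.mem_coe, mem_iInter, mem_ofPred_eq]
    exact hG p
  rw [h]
  refine isClosed_biInter fun q _ => isClosed_eq ?_ continuous_const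
  fun_prop

/-- The cross term is ⟨x, Ax⟩ = 0. All resolvent bounds below come from this identity. -/
theorem IsSkewAdjoint.norm_sq (hG : IsSkewAdjoint G) (ε : ℝ) {p : H × H} (hp : p ∈ G) :
    ‖p.1 - ε • p.2‖ ^ 2 = ‖p.1‖ ^ 2 + ε ^ 2 * ‖p.2‖ ^ 2 := by
  rw [norm_sub_sq_real, inner_smul_right, hG.inner_self hp, norm_smul, mul_pow, Real.norm_eq_abs,
    sq_abs]
  ring

theorem IsSkewAdjoint.norm_fst_le (hG : IsSkewAdjoint G) (ε : ℝ) {p : H × H} (hp : p ∈ G) :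
    ‖p.1‖ ≤ ‖p.1 - ε • p.2‖ := by
  refine le_of_sq_le_sq ?_ (norm_nonneg _)
  rw [hG.norm_sq ε hp]
  nlinarith [mul_nonneg (sq_nonneg ε) (sq_nonneg ‖p.2‖)]

/-- Curves that solve `z' = A z`, `z 0 = 0` for a skew-adjoint relation `A` vanish. -/
theorem IsSkewAdjoint.eq_zero_of_hasDerivWithinAt (hG : IsSkewAdjoint G) {z z' : ℝ → H} {T : ℝ}
    (hz : ∀ t ∈ Icc 0 T, HasDerivWithinAt z (z' t) (Icc 0 T) t)
    (hm : ∀ t ∈ Icc 0 T, (z t, z' t) ∈ G) (h0 : z 0 = 0) : ∀ t ∈ Icc 0 T, z t = 0 := by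
  intro t ht
  have hd : ∀ s ∈ Icc 0 T, HasDerivWithinAt (fun s => ‖z s‖ ^ 2) 0 (Icc 0 T) s := fun s hs => by
    have h := (hz s hs).norm_sq
    rwa [hG.inner_self (hm s hs), mul_zero] at h
  have h := Convex.norm_image_sub_le_of_norm_hasDerivWithin_le (C := 0) hd (by simp)
    (convex_Icc 0 T) (left_mem_Icc.2 (ht.1.trans ht.2)) ht
  simpa [h0] using h

/-- The bounded map `(x, y) ↦ x - ε y` on a linear relation. -/
def relShift (G : Submodule ℝ (H × H)) (ε : ℝ) : G →L[ℝ] H :=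
  (ContinuousLinearMap.fst ℝ H H - ε • ContinuousLinearMap.snd ℝ H H).comp G.subtypeL

theorem relShift_apply (ε : ℝ) (p : G) : relShift G ε p = (p : H × H).1 - ε • (p : H × H).2 := rfl

theorem IsSkewAdjoint.relShift_norm_le (hG : IsSkewAdjoint G) {ε : ℝ} (hε : ε ≠ 0) (p : G) :
    ‖p‖ ≤ max 1 (|ε|⁻¹) * ‖relShift G ε p‖ := by
  have hε' : 0 < |ε| := abs_pos.2 hε
  have h1 := hG.norm_fst_le ε p.2
  have h2 : ‖(p : H × H).2‖ ≤ |ε|⁻¹ * ‖relShift G ε p‖ := by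
    rw [le_inv_mul_iff₀ hε', relShift_apply]
    refine le_of_sq_le_sq ?_ (norm_nonneg _)
    rw [hG.norm_sq ε p.2, mul_pow, sq_abs]
    nlinarith [sq_nonneg ‖(p : H × H).1‖]
  rw [Submodule.coe_norm, Prod.norm_def]
  refine max_le ?_ (h2.trans ?_)
  · rw [← relShift_apply] at h1
    nlinarith [le_max_left 1 (|ε|⁻¹), norm_nonneg (relShift G ε p)]
  · gcongr
    exact le_max_right _ _

variable [CompleteSpace H]

/-- The lower bound gives injectivity and closed range; it remains to see that nothing is orthogonal
to the range. -/
theorem IsSkewAdjoint.relShift_bijective (hG : IsSkewAdjoint G) {ε : ℝ} (hε : ε ≠ 0) :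
    (relShift G ε).ker = ⊥ ∧ (relShift G ε).range = ⊤ := by
  have : CompleteSpace G := hG.isClosed.completeSpace_coe
  have hanti : AntilipschitzWith (⟨max 1 (|ε|⁻¹), by positivity⟩ : NNReal) (relShift G ε) :=
    (relShift G ε).antilipschitz_of_bound (hG.relShift_norm_le hε)
  have hclosed : IsClosed ((relShift G ε).range : Set H) :=
    hanti.isClosed_range (relShift G ε).uniformContinuous
  have hcomp : CompleteSpace (relShift G ε).range := hclosed.completeSpace_coe
  refine ⟨LinearMap.ker_eq_bot.2 hanti.injective, ?_⟩
  rw [← Submodule.orthogonal_eq_bot_iff, Submodule.eq_bot_iff]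
  intro z hz
  -- Orthogonality of z to every x - εy says precisely that (εz, -z) annihilates the relation, hence
  -- lies in it. Its own pairing is then -ε‖z‖² = 0.
  have hmem : ((ε • z, -z) : H × H) ∈ G := by
    refine (hG _).2 fun q hq => ?_
    have h := (Submodule.mem_orthogonal _ _).1 hz _ (LinearMap.mem_range_self _ (⟨q, hq⟩ : G))
    change ⟪q.1 - ε • q.2, z⟫_ℝ = 0 at h
    rw [inner_sub_left, inner_smul_left] at h
    simp only [conj_trivial] at h
    rw [inner_smul_left, inner_neg_left, real_inner_comm, real_inner_comm q.1]
    simp only [conj_trivial]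
    linarith
  have h := hG.inner_self hmem
  simp only [inner_neg_right, inner_smul_left, conj_trivial, neg_eq_zero, mul_eq_zero, hε,
    false_or, inner_self_eq_zero] at h
  exact h

/-- For a skew-adjoint relation and `ε ≠ 0`, the resolvent `z ↦ (x, y) ∈ G` with `x - ε y = z`. -/
theorem IsSkewAdjoint.exists_resolvent (hG : IsSkewAdjoint G) {ε : ℝ} (hε : ε ≠ 0) :
    ∃ R : H →L[ℝ] H, ∃ S : H →L[ℝ] H, ∀ z, (R z, S z) ∈ G ∧ R z - ε • S z = z := by
  have : CompleteSpace G := hG.isClosed.completeSpace_coe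
  obtain ⟨h1, h2⟩ := hG.relShift_bijective hε
  let e := ContinuousLinearEquiv.ofBijective (relShift G ε) h1 h2
  refine ⟨(ContinuousLinearMap.fst ℝ H H).comp (G.subtypeL.comp (e.symm : H →L[ℝ] G)),
    (ContinuousLinearMap.snd ℝ H H).comp (G.subtypeL.comp (e.symm : H →L[ℝ] G)), fun z => ?_⟩
  refine ⟨(e.symm z).2, ?_⟩
  exact e.apply_symm_apply z

open Classical in
/-- The resolvent `(1 - ε A)⁻¹` of a skew-adjoint relation `A` (the identity for `ε = 0`). -/
noncomputable def resolvent (hG : IsSkewAdjoint G) (ε : ℝ) : H →L[ℝ] H :=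
  if hε : ε ≠ 0 then (hG.exists_resolvent hε).choose else ContinuousLinearMap.id ℝ H

theorem resolvent_spec (hG : IsSkewAdjoint G) {ε : ℝ} (hε : ε ≠ 0) (z : H) :
    ∃ y, (resolvent hG ε z, y) ∈ G ∧ resolvent hG ε z - ε • y = z := by
  obtain ⟨S, hS⟩ := (hG.exists_resolvent hε).choose_spec
  refine ⟨S z, ?_⟩
  simp only [resolvent, dif_pos hε]
  exact hS z

theorem resolvent_eq (hG : IsSkewAdjoint G) {ε : ℝ} (hε : ε ≠ 0) {p : H × H} (hp : p ∈ G) :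
    resolvent hG ε (p.1 - ε • p.2) = p.1 := by
  obtain ⟨y, hy, h⟩ := resolvent_spec hG hε (p.1 - ε • p.2)
  have h1 := hG.norm_fst_le ε (G.sub_mem hy hp)
  have h2 : resolvent hG ε (p.1 - ε • p.2) - p.1 - ε • (y - p.2) = 0 := by
    rw [smul_sub]
    linear_combination (norm := module) h
  simp only [Prod.fst_sub, Prod.snd_sub, h2, norm_zero] at h1
  exact sub_eq_zero.1 (norm_le_zero_iff.1 h1)

theorem norm_resolvent_le (hG : IsSkewAdjoint G) {ε : ℝ} (hε : ε ≠ 0) (z : H) :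
    ‖resolvent hG ε z‖ ≤ ‖z‖ := by
  obtain ⟨y, hy, h⟩ := resolvent_spec hG hε z
  simpa only [h] using hG.norm_fst_le ε hy

/-- The adjoint of 1 - εA is 1 + εA, so the adjoint of the resolvent at ε is the resolvent at -ε. -/
theorem inner_resolvent (hG : IsSkewAdjoint G) {ε : ℝ} (hε : ε ≠ 0) (z w : H) :
    ⟪resolvent hG ε z, w⟫_ℝ = ⟪z, resolvent hG (-ε) w⟫_ℝ := by
  obtain ⟨y, hy, h⟩ := resolvent_spec hG hε z
  obtain ⟨y', hy', h'⟩ := resolvent_spec hG (neg_ne_zero.2 hε) w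
  have key := hG.inner_add hy hy'
  simp only at key
  conv_lhs => rw [← h']
  conv_rhs => rw [← h]
  simp only [inner_sub_left, inner_sub_right, inner_smul_left, inner_smul_right, conj_trivial]
  linear_combination ε * key

theorem resolvent_sub (hG : IsSkewAdjoint G) {ε : ℝ} (hε : ε ≠ 0) {p : H × H} (hp : p ∈ G) :
    resolvent hG ε p.1 - p.1 = ε • resolvent hG ε p.2 := by
  have h := resolvent_eq hG hε hp
  rw [map_sub, map_smul] at h
  linear_combination (norm := module) h

theorem resolvent_mem (hG : IsSkewAdjoint G) {ε : ℝ} (hε : ε ≠ 0) {p : H × H} (hp : p ∈ G) :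
    (resolvent hG ε p.1, resolvent hG ε p.2) ∈ G := by
  obtain ⟨y, hy, h⟩ := resolvent_spec hG hε p.1
  have h1 := resolvent_sub hG hε hp
  have h2 : y = resolvent hG ε p.2 := by
    refine smul_right_injective H hε ?_
    simp only
    rw [← h1]
    linear_combination (norm := module) -h
  rwa [← h2]

theorem resolvent_comm (hG : IsSkewAdjoint G) {ε δ : ℝ} (hε : ε ≠ 0) (hδ : δ ≠ 0) :
    Commute (resolvent hG ε) (resolvent hG δ) := by
  ext z
  obtain ⟨y, hy, h⟩ := resolvent_spec hG hε z
  have h1 := resolvent_eq hG hε (resolvent_mem hG hδ hy)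
  simp only [← map_smul, ← map_sub, h] at h1
  exact h1

/-- On the domain the error is ε times the resolvent of Ax, hence O(ε). Contractivity of the
resolvents extends the convergence to the closure of the domain. -/
theorem tendsto_resolvent (hG : IsSkewAdjoint G)
    (hd : Dense {x : H | ∃ y, (x, y) ∈ G}) {ε : ℕ → ℝ} (hε : ∀ k, ε k ≠ 0)
    (hlim : Tendsto ε atTop (𝓝 0)) (z : H) :
    Tendsto (fun k => resolvent hG (ε k) z) atTop (𝓝 z) := by
  rw [Metric.tendsto_atTop]
  intro η hη
  obtain ⟨x, ⟨y, hxy⟩, hx⟩ := Metric.mem_closure_iff.1 (hd z) (η / 3) (by positivity)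
  have h0 : Tendsto (fun k => |ε k| * ‖y‖) atTop (𝓝 0) := by
    simpa using (hlim.abs).mul_const ‖y‖
  obtain ⟨N, hN⟩ := (h0.eventually (gt_mem_nhds (show (0 : ℝ) < η / 3 by positivity))).exists_forall_of_atTop
  refine ⟨N, fun k hk => ?_⟩
  have h1 : ‖resolvent hG (ε k) x - x‖ ≤ |ε k| * ‖y‖ := by
    rw [resolvent_sub hG (hε k) hxy, norm_smul, Real.norm_eq_abs]
    exact mul_le_mul_of_nonneg_left (norm_resolvent_le hG (hε k) y) (abs_nonneg _)
  have h2 := norm_resolvent_le hG (hε k) (z - x)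
  rw [dist_eq_norm] at hx ⊢
  have h3 : resolvent hG (ε k) z - z
      = resolvent hG (ε k) (z - x) + (resolvent hG (ε k) x - x) - (z - x) := by
    rw [map_sub]; abel
  calc ‖resolvent hG (ε k) z - z‖
      ≤ ‖resolvent hG (ε k) (z - x)‖ + ‖resolvent hG (ε k) x - x‖ + ‖z - x‖ := by
        rw [h3]
        exact (norm_sub_le _ _).trans (add_le_add_left (norm_add_le _ _) _)
    _ < η := by linarith [hN k hk]

/-- The bounded skew-adjoint approximation `A (1 - ε² A²)⁻¹` of a skew-adjoint relation `A`. -/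
noncomputable def yosida (hG : IsSkewAdjoint G) (ε : ℝ) : H →L[ℝ] H :=
  (2 * ε)⁻¹ • (resolvent hG ε - resolvent hG (-ε))

theorem yosida_comm (hG : IsSkewAdjoint G) {ε δ : ℝ} (hε : ε ≠ 0) (hδ : δ ≠ 0) :
    Commute (yosida hG ε) (yosida hG δ) := by
  have hε' := neg_ne_zero.2 hε
  have hδ' := neg_ne_zero.2 hδ
  refine Commute.smul_left (Commute.smul_right ?_ _) _
  exact ((resolvent_comm hG hε hδ).sub_right (resolvent_comm hG hε hδ')).sub_left
    ((resolvent_comm hG hε' hδ).sub_right (resolvent_comm hG hε' hδ'))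

theorem inner_yosida (hG : IsSkewAdjoint G) {ε : ℝ} (hε : ε ≠ 0) (z w : H) :
    ⟪yosida hG ε z, w⟫_ℝ = - ⟪z, yosida hG ε w⟫_ℝ := by
  have h1 := inner_resolvent hG hε z w
  have h2 := inner_resolvent hG (neg_ne_zero.2 hε) z w
  rw [neg_neg] at h2
  simp only [yosida, smul_apply, sub_apply,
    inner_smul_left, inner_smul_right, inner_sub_left, inner_sub_right, conj_trivial, h1, h2]
  ring

theorem yosida_apply (hG : IsSkewAdjoint G) {ε : ℝ} (hε : ε ≠ 0) {p : H × H} (hp : p ∈ G) :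
    yosida hG ε p.1 = (2 : ℝ)⁻¹ • (resolvent hG ε p.2 + resolvent hG (-ε) p.2) := by
  have h1 := resolvent_sub hG hε hp
  have h2 := resolvent_sub hG (neg_ne_zero.2 hε) hp
  have h3 : resolvent hG ε p.1 - resolvent hG (-ε) p.1
      = ε • (resolvent hG ε p.2 + resolvent hG (-ε) p.2) := by
    rw [smul_add]
    rw [neg_smul] at h2
    linear_combination (norm := module) h1 - h2
  simp only [yosida, smul_apply, sub_apply, h3, smul_smul]
  congr 1
  field_simp

theorem tendsto_yosida (hG : IsSkewAdjoint G)
    (hd : Dense {x : H | ∃ y, (x, y) ∈ G}) {ε : ℕ → ℝ} (hε : ∀ k, ε k ≠ 0)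
    (hlim : Tendsto ε atTop (𝓝 0)) {p : H × H} (hp : p ∈ G) :
    Tendsto (fun k => yosida hG (ε k) p.1) atTop (𝓝 p.2) := by
  have h1 := tendsto_resolvent hG hd hε hlim p.2
  have h2 := tendsto_resolvent hG hd (fun k => neg_ne_zero.2 (hε k))
    (by simpa using hlim.neg) p.2
  have h3 := (h1.add h2).const_smul (2 : ℝ)⁻¹
  rw [← two_smul ℝ p.2, smul_smul, inv_mul_cancel₀ two_ne_zero, one_smul] at h3
  exact h3.congr fun k => (yosida_apply hG (hε k) hp).symm

theorem hasDerivAt_exp_smul_apply (B : H →L[ℝ] H) (x : H) (t : ℝ) :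
    HasDerivAt (fun t : ℝ => NormedSpace.exp (t • B) x) (NormedSpace.exp (t • B) (B x)) t :=
  (ContinuousLinearMap.apply ℝ H x).hasFDerivAt.comp_hasDerivAt t
    (hasDerivAt_exp_smul_const (𝕂 := ℝ) B t)

theorem hasDerivAt_exp_smul_apply' (B : H →L[ℝ] H) (x : H) (t : ℝ) :
    HasDerivAt (fun t : ℝ => NormedSpace.exp (t • B) x) (B (NormedSpace.exp (t • B) x)) t :=
  (ContinuousLinearMap.apply ℝ H x).hasFDerivAt.comp_hasDerivAt t
    (hasDerivAt_exp_smul_const' (𝕂 := ℝ) B t)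

/-- The derivative of the squared norm along the flow is 2⟨z, Bz⟩ = 0. -/
theorem norm_exp_smul_apply {B : H →L[ℝ] H} (hB : ∀ z w, ⟪B z, w⟫_ℝ = - ⟪z, B w⟫_ℝ) (x : H)
    (t : ℝ) : ‖NormedSpace.exp (t • B) x‖ = ‖x‖ := by
  have hd := fun s => (hasDerivAt_exp_smul_apply' B x s).norm_sq
  have h0 : ∀ z, ⟪z, B z⟫_ℝ = 0 := fun z => by
    have := hB z z
    rw [real_inner_comm] at this
    linarith
  have h := is_const_of_deriv_eq_zero (fun s => (hd s).differentiableAt)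
    (fun s => by rw [(hd s).deriv, h0, mul_zero]) t 0
  simp only [zero_smul, NormedSpace.exp_zero, one_apply_eq_self] at h
  exact (sq_eq_sq₀ (norm_nonneg _) (norm_nonneg _)).1 h

theorem norm_exp_smul_sub_le {B : H →L[ℝ] H} (hB : ∀ z w, ⟪B z, w⟫_ℝ = - ⟪z, B w⟫_ℝ) (x : H)
    (t : ℝ) : ‖NormedSpace.exp (t • B) x - x‖ ≤ ‖B x‖ * |t| := by
  have h := Convex.norm_image_sub_le_of_norm_hasDerivWithin_le
    (s := univ) (C := ‖B x‖) (x := 0) (y := t)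
    (fun s _ => (hasDerivAt_exp_smul_apply B x s).hasDerivWithinAt)
    (fun s _ => (norm_exp_smul_apply hB (B x) s).le) convex_univ (mem_univ _) (mem_univ _)
  simpa using h

/-- Commutation factors the difference as the isometry e^{tB} applied to e^{t(C-B)}x - x. This makes
the approximate flows Cauchy on vectors in the domain of A. -/
theorem norm_exp_smul_sub_exp_smul_le {B C : H →L[ℝ] H} (hBC : Commute B C)
    (hB : ∀ z w, ⟪B z, w⟫_ℝ = - ⟪z, B w⟫_ℝ) (hC : ∀ z w, ⟪C z, w⟫_ℝ = - ⟪z, C w⟫_ℝ) (x : H)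
    (t : ℝ) :
    ‖NormedSpace.exp (t • C) x - NormedSpace.exp (t • B) x‖ ≤ ‖C x - B x‖ * |t| := by
  let _ : NormedAlgebra ℚ (H →L[ℝ] H) := NormedAlgebra.restrictScalars ℚ ℝ _
  have h1 : t • C = t • B + t • (C - B) := by rw [smul_sub]; abel
  have h2 : Commute (t • B) (t • (C - B)) :=
    ((hBC.sub_right (Commute.refl B)).smul_right t).smul_left t
  have h3 : ∀ z w, ⟪(C - B) z, w⟫_ℝ = - ⟪z, (C - B) w⟫_ℝ := fun z w => by
    simp only [sub_apply, inner_sub_left, inner_sub_right, hB, hC]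
    ring
  rw [h1, NormedSpace.exp_add_of_commute h2, mul_apply_eq_comp, ← map_sub,
    norm_exp_smul_apply hB]
  exact norm_exp_smul_sub_le h3 x t

/-- Every skew-adjoint relation with dense domain generates an isometric flow: through each `x`
passes a continuous curve of constant norm which solves `u' = A u` in the integrated sense. -/
theorem IsSkewAdjoint.exists_flow (hG : IsSkewAdjoint G)
    (hd : Dense {x : H | ∃ y, (x, y) ∈ G}) (x : H) :
    ∃ u : ℝ → H, Continuous u ∧ u 0 = x ∧ (∀ t, ‖u t‖ = ‖x‖) ∧
      ∀ t, (∫ s in (0 : ℝ)..t, u s, u t - x) ∈ G := by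
  set ε : ℕ → ℝ := fun k => 1 / ((k : ℝ) + 1) with hεdef
  have hε : ∀ k, ε k ≠ 0 := fun k => by positivity
  have hlim : Tendsto ε atTop (𝓝 0) := tendsto_one_div_add_atTop_nhds_zero_nat
  set B : ℕ → H →L[ℝ] H := fun k => yosida hG (ε k) with hBdef
  have hB : ∀ k z w, ⟪B k z, w⟫_ℝ = - ⟪z, B k w⟫_ℝ := fun k => inner_yosida hG (hε k)
  have hBB : ∀ k l, Commute (B k) (B l) := fun k l => yosida_comm hG (hε k) (hε l)
  set E : ℕ → ℝ → H := fun k t => NormedSpace.exp (t • B k) x with hEdef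
  have hEn : ∀ k t, ‖E k t‖ = ‖x‖ := fun k t => norm_exp_smul_apply (hB k) x t
  have hEc : ∀ k, Continuous (E k) := fun k =>
    continuous_iff_continuousAt.2 fun t => (hasDerivAt_exp_smul_apply (B k) x t).continuousAt
  -- Replace x by a nearby z in the domain, where the Yosida approximations converge; each isometry
  -- turns the replacement into an error of at most η/4.
  have hcauchy : ∀ T, UniformCauchySeqOn E atTop (Icc (-T) T) := by
    intro T
    rw [Metric.uniformCauchySeqOn_iff]
    intro η hη
    obtain ⟨z, ⟨y, hzy⟩, hz⟩ := Metric.mem_closure_iff.1 (hd x) (η / 4) (by positivity)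
    have hBz : CauchySeq fun k => B k z := (tendsto_yosida hG hd hε hlim hzy).cauchySeq
    obtain ⟨N, hN⟩ := Metric.cauchySeq_iff.1 hBz (η / (4 * (|T| + 1))) (by positivity)
    refine ⟨N, fun k hk l hl t ht => ?_⟩
    have htT : |t| ≤ |T| := (abs_le.2 ht).trans (le_abs_self T)
    have h1 := norm_exp_smul_sub_exp_smul_le (hBB l k) (hB l) (hB k) z t
    have h2 := (hN k hk l hl).le
    rw [dist_eq_norm] at h2 hz ⊢
    have h3 : ‖B k z - B l z‖ * |t| ≤ η / 4 := by
      calc ‖B k z - B l z‖ * |t| ≤ η / (4 * (|T| + 1)) * (|T| + 1) := by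
            gcongr
            linarith
        _ = η / 4 := by field_simp
    have h4 : E k t - E l t = NormedSpace.exp (t • B k) (x - z) - NormedSpace.exp (t • B l) (x - z)
        + (NormedSpace.exp (t • B k) z - NormedSpace.exp (t • B l) z) := by
      simp only [hEdef, map_sub]; abel
    calc ‖E k t - E l t‖ ≤ ‖x - z‖ + ‖x - z‖ + η / 4 := by
          rw [h4]
          refine (norm_add_le _ _).trans (add_le_add ((norm_sub_le _ _).trans ?_) (h1.trans h3))
          rw [norm_exp_smul_apply (hB k), norm_exp_smul_apply (hB l)]
      _ < η := by linarith
  have hpt : ∀ t, ∃ y, Tendsto (fun k => E k t) atTop (𝓝 y) := fun t =>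
    cauchySeq_tendsto_of_complete ((hcauchy |t|).cauchySeq (abs_le.1 le_rfl))
  choose u hu using hpt
  have hunif : ∀ T, TendstoUniformlyOn E u atTop (Icc (-T) T) := fun T =>
    (hcauchy T).tendstoUniformlyOn_of_tendsto fun t _ => hu t
  have huc : Continuous u := by
    refine continuous_iff_continuousAt.2 fun t => ?_
    have h := (hunif (|t| + 1)).continuousOn
      (Eventually.of_forall fun k => (hEc k).continuousOn).frequently
    refine h.continuousAt (Icc_mem_nhds ?_ ?_)
    · linarith [neg_abs_le t]
    · linarith [le_abs_self t]
  refine ⟨u, huc, ?_, fun t => ?_, fun t => ?_⟩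
  · refine tendsto_nhds_unique (hu 0) ?_
    simp [hEdef]
  · refine tendsto_nhds_unique (hu t).norm ?_
    simp [hEn]
  · have hint : Tendsto (fun k => ∫ s in (0 : ℝ)..t, E k s) atTop (𝓝 (∫ s in (0 : ℝ)..t, u s)) :=
      intervalIntegral.tendsto_integral_filter_of_dominated_convergence (fun _ => ‖x‖)
        (Eventually.of_forall fun k => (hEc k).aestronglyMeasurable)
        (Eventually.of_forall fun k => Eventually.of_forall fun s _ => (hEn k s).le)
        intervalIntegrable_const (Eventually.of_forall fun s _ => hu s)
    have hk : ∀ k, B k (∫ s in (0 : ℝ)..t, E k s) = E k t - x := by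
      intro k
      rw [← ContinuousLinearMap.intervalIntegral_comp_comm _ ((hEc k).intervalIntegrable _ _)]
      rw [intervalIntegral.integral_eq_sub_of_hasDerivAt
        (fun s _ => hasDerivAt_exp_smul_apply' (B k) x s)
        (((B k).continuous.comp (hEc k)).intervalIntegrable _ _)]
      simp [hEdef]
    -- Membership is tested by duality: moving B_k onto q.1 by skewness leaves B_k q.1, which
    -- converges to q.2, so no convergence of B_k on the limit curve is needed.
    refine (hG _).2 fun q hq => ?_
    have h1 := hint.inner (𝕜 := ℝ) (tendsto_yosida hG hd hε hlim hq)
    have h2 := ((hu t).sub_const x).inner (𝕜 := ℝ) (tendsto_const_nhds (x := q.1))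
    have h3 : ∀ k, ⟪E k t - x, q.1⟫_ℝ = - ⟪∫ s in (0 : ℝ)..t, E k s, B k q.1⟫_ℝ := fun k => by
      rw [← hk, hB]
    have h4 := tendsto_nhds_unique (h2.congr h3) h1.neg
    simp only [h4]
    ring

end SkewAdjoint

/-! ### The Jacobi matrix with its boundary condition at infinity -/

section Jacobi

/-- Real square summable sequences. -/
abbrev Seq2 : Type := lp (fun _ : ℕ => ℝ) 2

theorem memℓp_two_iff {E : Type*} [NormedAddCommGroup E] {f : ℕ → E} :
    Memℓp f 2 ↔ Summable fun n => ‖f n‖ ^ 2 := by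
  rw [memℓp_gen_iff (by norm_num)]
  simp

theorem memℓp_two_iff_real {f : ℕ → ℝ} : Memℓp f 2 ↔ Summable fun n => f n ^ 2 := by
  rw [memℓp_two_iff]
  simp

theorem Seq2.hasSum_inner (x y : Seq2) : HasSum (fun n => x n * y n) (inner ℝ x y) := by
  have h := lp.hasSum_inner (𝕜 := ℝ) x y
  simp only [RCLike.inner_apply, conj_trivial] at h
  simpa only [mul_comm] using h

/-- The skew-symmetric Jacobi expression `(A a)_n = (α_n a_{n+1} - α_{n-1} a_{n-1}) / 2`. -/
noncomputable def skewJacobi (a : ℕ → ℝ) : ℕ → ℝ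
  | 0 => 0
  | n + 1 => (jacobiCoeff (n + 1) * a (n + 2) - jacobiCoeff n * a n) / 2

/-- The boundary form of `skewJacobi`. -/
noncomputable def bdryForm (x z : ℕ → ℝ) (n : ℕ) : ℝ :=
  jacobiCoeff n * (x n * z (n + 1) + x (n + 1) * z n)

theorem jacobiCoeff_zero : jacobiCoeff 0 = 0 := by simp [jacobiCoeff]

/-- Discrete Green identity: the sum telescopes, and the lower boundary term disappears because
`jacobiCoeff 0 = 0`. -/
theorem sum_skewJacobi (x z : ℕ → ℝ) (n : ℕ) :
    ∑ k ∈ Finset.range (n + 1), (x k * skewJacobi z k + skewJacobi x k * z k)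
      = bdryForm x z n / 2 := by
  induction n with
  | zero => simp [skewJacobi, bdryForm, jacobiCoeff_zero]
  | succ n ih =>
    rw [Finset.sum_range_succ, ih]
    simp only [skewJacobi, bdryForm]
    ring

theorem skewJacobi_add (x z : ℕ → ℝ) : skewJacobi (x + z) = skewJacobi x + skewJacobi z := by
  funext n
  cases n with
  | zero => simp [skewJacobi]
  | succ n => simp only [skewJacobi, Pi.add_apply]; ring

theorem skewJacobi_smul (c : ℝ) (x : ℕ → ℝ) : skewJacobi (c • x) = c • skewJacobi x := by
  funext n
  cases n with
  | zero => simp [skewJacobi]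
  | succ n => simp only [skewJacobi, Pi.smul_apply, smul_eq_mul]; ring

/-- The sequences with `√(n+3) s_{n+2} = √n s_n` for `n ≥ 1`, with prescribed first two entries. -/
noncomputable def homSol (a b : ℝ) : ℕ → ℝ
  | 0 => 0
  | 1 => a
  | 2 => b
  | n + 3 => Real.sqrt (n + 1) / Real.sqrt (n + 4) * homSol a b (n + 1)

theorem jacobiCoeff_mul_homSol (a b : ℝ) (n : ℕ) :
    jacobiCoeff (n + 2) * homSol a b (n + 3) = jacobiCoeff (n + 1) * homSol a b (n + 1) := by
  have h1 : jacobiCoeff (n + 2)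
      = Real.sqrt (((n : ℝ) + 2) * (n + 3)) * Real.sqrt (n + 4) := by
    unfold jacobiCoeff
    rw [← Real.sqrt_mul (by positivity)]
    congr 1
    push_cast
    ring
  have h2 : jacobiCoeff (n + 1)
      = Real.sqrt (((n : ℝ) + 2) * (n + 3)) * Real.sqrt (n + 1) := by
    unfold jacobiCoeff
    rw [← Real.sqrt_mul (by positivity)]
    congr 1
    push_cast
    ring
  have h3 : Real.sqrt ((n : ℝ) + 4) ≠ 0 := by positivity
  rw [h1, h2, homSol]
  field_simp

theorem skewJacobi_homSol_zero (a b : ℝ) : skewJacobi (homSol a b) 0 = 0 := rfl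

theorem skewJacobi_homSol_one (a b : ℝ) : skewJacobi (homSol a b) 1 = jacobiCoeff 1 * b / 2 := by
  simp [skewJacobi, homSol]

theorem skewJacobi_homSol_add_two (a b : ℝ) (n : ℕ) : skewJacobi (homSol a b) (n + 2) = 0 := by
  simp only [skewJacobi, jacobiCoeff_mul_homSol]
  ring

/-- The weighted squares n s_n² drop by at least s_n²/4 from n to n + 2, so the squares are bounded
by a telescoping sum. This is the limit-circle property. -/
theorem memℓp_homSol (a b : ℝ) : Memℓp (homSol a b) 2 := by
  rw [memℓp_two_iff_real]
  set s := homSol a b with hs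
  have hrec : ∀ n : ℕ, s (n + 3) ^ 2 = (n + 1) / (n + 4) * s (n + 1) ^ 2 := fun n => by
    rw [hs, homSol, mul_pow, div_pow, Real.sq_sqrt (by positivity), Real.sq_sqrt (by positivity)]
  have key : ∀ N : ℕ, ∑ k ∈ Finset.range (N + 1), s k ^ 2
      + 4 * ((N + 1) * s (N + 1) ^ 2 + (N + 2) * s (N + 2) ^ 2) ≤ 4 * (a ^ 2 + 2 * b ^ 2) := by
    intro N
    induction N with
    | zero => simp [hs, homSol]
    | succ N ih =>
      rw [Finset.sum_range_succ]
      have h : ((N : ℝ) + 3) * s (N + 3) ^ 2 ≤ (N + 1) * s (N + 1) ^ 2 - s (N + 1) ^ 2 / 4 := by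
        rw [hrec]
        -- The drop is (N+1)/(N+4), smallest at N = 0; this fixes the constant 1/4 here and the
        -- factor 4 in `key`.
        have h1 : ((N : ℝ) + 3) * ((N + 1) / (N + 4)) ≤ N + 1 - 1 / 4 := by
          rw [mul_div_assoc', div_le_iff₀ (by positivity)]
          nlinarith [(Nat.cast_nonneg N : (0 : ℝ) ≤ N)]
        nlinarith [mul_le_mul_of_nonneg_right h1 (sq_nonneg (s (N + 1)))]
      push_cast
      have e1 : (N : ℝ) + 1 + 2 = N + 3 := by ring
      have e2 : (N : ℝ) + 1 + 1 = N + 2 := by ring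
      rw [e1, e2]
      change _ + 4 * ((N + 2) * s (N + 2) ^ 2 + (N + 3) * s (N + 3) ^ 2) ≤ _
      linarith
  refine summable_of_sum_range_le (c := 4 * (a ^ 2 + 2 * b ^ 2)) (fun n => sq_nonneg _) fun n => ?_
  cases n with
  | zero => simp only [Finset.range_zero, Finset.sum_empty]; positivity
  | succ N =>
    have : 0 ≤ 4 * (((N : ℝ) + 1) * s (N + 1) ^ 2 + (N + 2) * s (N + 2) ^ 2) := by positivity
    linarith [key N]

/-- The recursion has step two, so the first sequence lives on odd indices and the second on even
ones. -/
theorem homSol_mul_homSol (n : ℕ) : homSol 1 0 n * homSol 0 1 n = 0 := by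
  have h : ∀ n, homSol 1 0 n * homSol 0 1 n = 0 ∧ homSol 1 0 (n + 1) * homSol 0 1 (n + 1) = 0 ∧
      homSol 1 0 (n + 2) * homSol 0 1 (n + 2) = 0 := by
    intro n
    induction n with
    | zero => simp [homSol]
    | succ n ih =>
      refine ⟨ih.2.1, ih.2.2, ?_⟩
      simp only [homSol]
      linear_combination (Real.sqrt (n + 1) / Real.sqrt (n + 4)) ^ 2 * ih.2.1
  exact (h n).1

theorem homSol_mul_homSol_succ (n : ℕ) : homSol 1 0 n * homSol 1 0 (n + 1) = 0 := by
  have h : ∀ n, homSol 1 0 n * homSol 1 0 (n + 1) = 0 ∧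
      homSol 1 0 (n + 1) * homSol 1 0 (n + 2) = 0 ∧
      homSol 1 0 (n + 2) * homSol 1 0 (n + 3) = 0 := by
    intro n
    induction n with
    | zero => simp [homSol]
    | succ n ih =>
      refine ⟨ih.2.1, ih.2.2, ?_⟩
      simp only [homSol]
      linear_combination (Real.sqrt (n + 1) / Real.sqrt (n + 4))
        * (Real.sqrt ((n + 1 : ℕ) + 1) / Real.sqrt ((n + 1 : ℕ) + 4)) * ih.2.1
  exact (h n).1

/-- By Green's identity the form is constant, as both sequences solve the homogeneous equation from
row 2 on; only row 1 contributes. -/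
theorem bdryForm_homSol (n : ℕ) :
    bdryForm (homSol 1 0) (homSol 0 1) (n + 1) = jacobiCoeff 1 := by
  have h := sum_skewJacobi (homSol 1 0) (homSol 0 1) (n + 1)
  rw [Finset.sum_range_succ', Finset.sum_range_succ'] at h
  simp only [skewJacobi_homSol_add_two, skewJacobi_homSol_zero, zero_add,
    skewJacobi_homSol_one] at h
  simp [homSol] at h
  linarith

/-- Plücker identity for 2 × 2 minors. The form carries a plus sign instead of a minus, and the
extra terms this produces contain products of the two reference sequences at the same index, which
vanish by parity. -/
theorem bdryForm_mul_bdryForm (x z : ℕ → ℝ) (n : ℕ) :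
    bdryForm (homSol 1 0) (homSol 0 1) n * bdryForm x z n
      = bdryForm (homSol 0 1) x n * bdryForm (homSol 1 0) z n
        + bdryForm (homSol 1 0) x n * bdryForm (homSol 0 1) z n := by
  have h1 := homSol_mul_homSol n
  have h2 := homSol_mul_homSol (n + 1)
  unfold bdryForm
  linear_combination (-2 * jacobiCoeff n ^ 2 * x (n + 1) * z (n + 1)) * h1
    - (2 * jacobiCoeff n ^ 2 * x n * z n) * h2

/-- `skewJacobi` maps these sequences to multiples of the first unit vector. -/
theorem memℓp_skewJacobi_homSol (a b : ℝ) : Memℓp (skewJacobi (homSol a b)) 2 := by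
  rw [memℓp_two_iff_real]
  refine summable_of_ne_finset_zero (s := {1}) fun n hn => ?_
  match n with
  | 0 => simp [skewJacobi]
  | 1 => simp at hn
  | n + 2 => simp [skewJacobi_homSol_add_two]

/-- The graph of the skew-adjoint Jacobi operator with the boundary condition at infinity given
by the solution of `A q = 0`. -/
noncomputable def jacobiRel : Submodule ℝ (Seq2 × Seq2) where
  carrier := {p | (∀ n, p.2 n = skewJacobi p.1 n) ∧
    Tendsto (bdryForm (homSol 1 0) p.1) atTop (𝓝 0)}
  add_mem' := by
    rintro p q ⟨hp1, hp2⟩ ⟨hq1, hq2⟩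
    refine ⟨fun n => ?_, ?_⟩
    · have h := congrFun (skewJacobi_add p.1 q.1) n
      simp only [Prod.fst_add, Prod.snd_add, lp.coeFn_add, Pi.add_apply] at h ⊢
      rw [h, hp1, hq1]
    · have h := hp2.add hq2
      rw [add_zero] at h
      refine h.congr fun n => ?_
      simp only [bdryForm, Prod.fst_add, lp.coeFn_add, Pi.add_apply]
      ring
  zero_mem' := by
    refine ⟨fun n => ?_, ?_⟩
    · cases n <;> simp [skewJacobi]
    · refine tendsto_const_nhds.congr fun n => ?_
      simp [bdryForm]
  smul_mem' := by
    rintro c p ⟨hp1, hp2⟩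
    refine ⟨fun n => ?_, ?_⟩
    · have h := congrFun (skewJacobi_smul c p.1) n
      simp only [Prod.smul_fst, Prod.smul_snd, lp.coeFn_smul, Pi.smul_apply] at h ⊢
      rw [h, hp1]
    · have h := hp2.const_mul c
      rw [mul_zero] at h
      refine h.congr fun n => ?_
      simp only [bdryForm, Prod.smul_fst, lp.coeFn_smul, Pi.smul_apply, smul_eq_mul]
      ring

theorem mem_jacobiRel {p : Seq2 × Seq2} : p ∈ jacobiRel ↔ (∀ n, p.2 n = skewJacobi p.1 n) ∧
    Tendsto (bdryForm (homSol 1 0) p.1) atTop (𝓝 0) := Iff.rfl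

/-- Passing to the limit in Green's identity: boundary values at infinity exist on the maximal
domain. -/
theorem tendsto_bdryForm {x y z w : Seq2} (hy : ∀ n, y n = skewJacobi x n)
    (hw : ∀ n, w n = skewJacobi z n) :
    Tendsto (bdryForm x z) atTop (𝓝 (2 * (inner ℝ x w + inner ℝ y z))) := by
  have h := ((Seq2.hasSum_inner x w).add (Seq2.hasSum_inner y z)).tendsto_sum_nat
  have h' := ((tendsto_add_atTop_iff_nat 1).2 h).const_mul 2
  refine h'.congr fun n => ?_
  simp only [hw, hy, sum_skewJacobi]
  ring

theorem skewJacobi_single_eq_zero {k m : ℕ} (h : k + 2 ≤ m) :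
    skewJacobi (Pi.single k 1) m = 0 := by
  obtain ⟨n, rfl⟩ : ∃ n, m = n + 1 := ⟨m - 1, by omega⟩
  have h1 : n + 2 ≠ k := by omega
  have h2 : n ≠ k := by omega
  simp [skewJacobi, h1, h2]

theorem memℓp_skewJacobi_single (k : ℕ) : Memℓp (skewJacobi (Pi.single k 1)) 2 := by
  rw [memℓp_two_iff_real]
  refine summable_of_ne_finset_zero (s := Finset.range (k + 2)) fun n hn => ?_
  rw [Finset.mem_range, not_lt] at hn
  simp [skewJacobi_single_eq_zero hn]

theorem bdryForm_single_eventually (x : ℕ → ℝ) (k : ℕ) :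
    ∀ᶠ n in atTop, bdryForm x (Pi.single k 1) n = 0 := by
  filter_upwards [eventually_gt_atTop k] with n hn
  have h1 : n + 1 ≠ k := by omega
  have h2 : n ≠ k := by omega
  simp [bdryForm, h1, h2]

theorem single_mem_jacobiRel (k : ℕ) :
    ((lp.single 2 k (1 : ℝ), ⟨_, memℓp_skewJacobi_single k⟩) : Seq2 × Seq2) ∈ jacobiRel := by
  refine mem_jacobiRel.2 ⟨fun n => ?_, ?_⟩
  · simp only [lp.coeFn_single]
  · simp only [lp.coeFn_single]
    exact tendsto_const_nhds.congr'
      ((bdryForm_single_eventually (homSol 1 0) k).mono fun n hn => hn.symm)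

/-- Symmetry comes from the Plücker identity at infinity. Maximality comes from testing against
finitely supported sequences and the square summable kernel solution. -/
theorem isSkewAdjoint_jacobiRel : IsSkewAdjoint jacobiRel := by
  intro p
  constructor
  · rintro ⟨hp1, hp2⟩ r ⟨hr1, hr2⟩
    have hlim := tendsto_bdryForm hp1 hr1
    -- The boundary form with this second solution merely converges, while the form with `homSol 1
    -- 0` tends to 0; each Plücker product contains one factor of each kind.
    let s : Seq2 := ⟨homSol 0 1, memℓp_homSol 0 1⟩
    let s' : Seq2 := ⟨skewJacobi (homSol 0 1), memℓp_skewJacobi_homSol 0 1⟩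
    have h1 := tendsto_bdryForm (x := s) (y := s') (fun _ => rfl) hp1
    have h2 := tendsto_bdryForm (x := s) (y := s') (fun _ => rfl) hr1
    have h3 := (h1.mul hr2).add (hp2.mul h2)
    rw [mul_zero, zero_mul, add_zero] at h3
    have h4 := hlim.const_mul (jacobiCoeff 1)
    have h5 : ∀ᶠ n in atTop, bdryForm s p.1 n * bdryForm (homSol 1 0) r.1 n
        + bdryForm (homSol 1 0) p.1 n * bdryForm s r.1 n
        = jacobiCoeff 1 * bdryForm p.1 r.1 n := by
      filter_upwards [eventually_gt_atTop 0] with n hn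
      obtain ⟨m, rfl⟩ : ∃ m, n = m + 1 := ⟨n - 1, by omega⟩
      rw [← bdryForm_homSol m, bdryForm_mul_bdryForm]
    have h6 := tendsto_nhds_unique (h3.congr' h5) h4
    have h7 : jacobiCoeff 1 ≠ 0 := by
      unfold jacobiCoeff
      positivity
    have h8 := (mul_eq_zero.1 h6.symm).resolve_left h7
    linarith
  · intro h
    have hA : ∀ n, p.2 n = skewJacobi p.1 n := by
      intro k
      -- Pairing with the k-th unit vector reads off row k; no boundary term arises because the test
      -- sequence has finite support.
      have h1 := h _ (single_mem_jacobiRel k)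
      set e : Seq2 := lp.single 2 k (1 : ℝ)
      set e' : Seq2 := ⟨_, memℓp_skewJacobi_single k⟩
      have he : (e : ℕ → ℝ) = Pi.single k 1 := lp.coeFn_single ..
      have h2 : inner ℝ p.2 e = p.2 k := by
        rw [lp.inner_single_right]
        simp
      have h3 : HasSum (fun n => skewJacobi p.1 n * e n) (skewJacobi p.1 k) := by
        have := hasSum_single (f := fun n => skewJacobi p.1 n * e n) k fun n hn => by simp [he, hn]
        simpa [he] using this
      have h4 := ((Seq2.hasSum_inner p.1 e').add h3).tendsto_sum_nat
      have h5 := (tendsto_add_atTop_iff_nat 1).2 h4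
      have h6 : Tendsto (fun n => bdryForm p.1 (Pi.single k 1) n / 2) atTop (𝓝 0) := by
        refine tendsto_const_nhds.congr' ?_
        filter_upwards [bdryForm_single_eventually p.1 k] with n hn
        simp only [hn, zero_div]
      have h7 : inner ℝ p.1 e' + skewJacobi p.1 k = 0 := by
        refine tendsto_nhds_unique h5 (h6.congr fun n => ?_)
        rw [← sum_skewJacobi, he]
      simp only [h2] at h1
      linarith
    refine mem_jacobiRel.2 ⟨hA, ?_⟩
    -- The kernel solution satisfies its own boundary condition, so (s, 0) is an admissible test
    -- pair. Pairing with it gives the limit of the boundary form, which must be 0.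
    let s : Seq2 := ⟨homSol 1 0, memℓp_homSol 1 0⟩
    have hs : ∀ n, (0 : Seq2) n = skewJacobi s n := fun n => by
      match n with
      | 0 => simp [skewJacobi]
      | 1 => simp [s, skewJacobi_homSol_one]
      | n + 2 => simp [s, skewJacobi_homSol_add_two]
    have hmem : ((s, 0) : Seq2 × Seq2) ∈ jacobiRel := by
      refine mem_jacobiRel.2 ⟨hs, tendsto_const_nhds.congr fun n => ?_⟩
      have := homSol_mul_homSol_succ n
      simp only [bdryForm, s]
      linear_combination (-2 * jacobiCoeff n) * this
    have h1 := h _ hmem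
    have h2 := tendsto_bdryForm hs hA
    simp only [inner_zero_right, inner_zero_left, zero_add, add_zero] at h1 h2
    rw [real_inner_comm, h1, mul_zero] at h2
    exact h2

theorem dense_domain_jacobiRel : Dense {x : Seq2 | ∃ y, (x, y) ∈ jacobiRel} := by
  intro x
  refine mem_closure_of_tendsto (lp.hasSum_single (by norm_num) x) (Eventually.of_forall fun s => ?_)
  choose y hy using fun k : ℕ => (⟨_, single_mem_jacobiRel k⟩ :
    ∃ y, ((lp.single 2 k (1 : ℝ), y) : Seq2 × Seq2) ∈ jacobiRel)
  refine ⟨∑ k ∈ s, x k • y k, ?_⟩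
  have h := jacobiRel.sum_mem (t := s) fun k _ => jacobiRel.smul_mem (x k) (hy k)
  convert h using 1
  rw [Prod.ext_iff, Prod.fst_sum, Prod.snd_sum]
  refine ⟨Finset.sum_congr rfl fun k _ => ?_, rfl⟩
  rw [Prod.smul_fst, ← lp.single_smul, smul_eq_mul, mul_one]

theorem vSeq_eq_homSol (n : ℕ) : (vSeq n : ℂ) = Complex.I * (Complex.I ^ n)⁻¹ * homSol 1 0 n := by
  have h : ∀ n, (vSeq n : ℂ) = Complex.I * (Complex.I ^ n)⁻¹ * homSol 1 0 n ∧
      (vSeq (n + 1) : ℂ) = Complex.I * (Complex.I ^ (n + 1))⁻¹ * homSol 1 0 (n + 1) ∧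
      (vSeq (n + 2) : ℂ) = Complex.I * (Complex.I ^ (n + 2))⁻¹ * homSol 1 0 (n + 2) := by
    intro n
    induction n with
    | zero => simp [vSeq, homSol]
    | succ n ih =>
      refine ⟨ih.2.1, ih.2.2, ?_⟩
      have e1 : vSeq (n + 3) = -(Real.sqrt (n + 1) / Real.sqrt (n + 4)) * vSeq (n + 1) := by
        rw [vSeq]
        push_cast
        congr 4
        ring
      change (vSeq (n + 3) : ℂ) = Complex.I * (Complex.I ^ (n + 3))⁻¹ * homSol 1 0 (n + 3)
      have e2 : (Complex.I ^ (n + 3))⁻¹ = -(Complex.I ^ (n + 1))⁻¹ := by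
        rw [show n + 3 = n + 1 + 2 from rfl, pow_add, Complex.I_sq, mul_neg_one, inv_neg]
      rw [e1, e2, homSol]
      push_cast
      rw [ih.2.1]
      ring
  exact (h n).1

/-- The unimodular twist i^{-n} carries the skew matrix to a unimodular multiple of J; the factor 2
is the normalisation in `skewJacobi`. -/
theorem norm_jacobi (a : ℕ → ℝ) (n : ℕ) :
    ‖jacobi (fun n => (Complex.I ^ n)⁻¹ * (a n : ℂ)) n‖ = 2 * ‖skewJacobi a n‖ := by
  cases n with
  | zero => simp [jacobi, skewJacobi]
  | succ n =>
    have h : jacobi (fun n => (Complex.I ^ n)⁻¹ * (a n : ℂ)) (n + 1)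
        = -(Complex.I ^ n)⁻¹ * ((2 * skewJacobi a (n + 1) : ℝ) : ℂ) := by
      have e2 : (Complex.I ^ (n + 2))⁻¹ = -(Complex.I ^ n)⁻¹ := by
        rw [pow_add, Complex.I_sq, mul_neg_one, inv_neg]
      simp only [jacobi, skewJacobi, e2]
      push_cast
      ring
    rw [h, norm_mul, norm_neg, norm_inv, norm_pow, Complex.norm_I, one_pow, inv_one, one_mul,
      Complex.norm_real, norm_mul]
    norm_num

/-- The two expressions differ by a sign inside the bracket, which is harmless because one of two
consecutive entries of `homSol 1 0` is zero. -/
theorem norm_wronskian (a : ℕ → ℝ) (n : ℕ) :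
    ‖wronskian (fun k => (vSeq k : ℂ)) (fun n => (Complex.I ^ n)⁻¹ * (a n : ℂ)) n‖
      = ‖bdryForm (homSol 1 0) a n‖ := by
  have h : wronskian (fun k => (vSeq k : ℂ)) (fun n => (Complex.I ^ n)⁻¹ * (a n : ℂ)) n
      = Complex.I * (Complex.I ^ n)⁻¹ * (Complex.I ^ (n + 1))⁻¹ *
        ((jacobiCoeff n * (homSol 1 0 n * a (n + 1) - homSol 1 0 (n + 1) * a n) : ℝ) : ℂ) := by
    simp only [wronskian, vSeq_eq_homSol]
    push_cast
    ring
  rw [h]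
  simp only [norm_mul, norm_inv, norm_pow, Complex.norm_I, one_pow, inv_one, one_mul,
    Complex.norm_real, bdryForm]
  rcases mul_eq_zero.1 (homSol_mul_homSol_succ n) with h | h
  · simp [h]
  · simp [h]

theorem mem_jacobiDomain_iff (a : ℕ → ℝ) :
    (fun n => (Complex.I ^ n)⁻¹ * (a n : ℂ)) ∈ jacobiDomain ↔
      Memℓp a 2 ∧ Memℓp (skewJacobi a) 2 ∧ Tendsto (bdryForm (homSol 1 0) a) atTop (𝓝 0) := by
  change _ ∧ _ ∧ _ ↔ _
  rw [memℓp_two_iff, memℓp_two_iff, memℓp_two_iff, memℓp_two_iff]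
  simp only [norm_jacobi, mul_pow]
  rw [summable_mul_left_iff (by norm_num), tendsto_zero_iff_norm_tendsto_zero,
    tendsto_zero_iff_norm_tendsto_zero (f := bdryForm _ _)]
  simp only [norm_wronskian]
  simp

end Jacobi

/-! ### Hermite functions: ladder relations, orthonormality, completeness -/

section Hermite

open Polynomial in
theorem derivative_hermite (n : ℕ) :
    derivative (hermite n) = (n : ℤ[X]) * hermite (n - 1) := by
  induction n with
  | zero => simp
  | succ n ih =>
    rw [hermite_succ, derivative_sub, derivative_mul, derivative_X, ih, derivative_mul,
      derivative_natCast]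
    cases n with
    | zero => simp
    | succ n =>
      simp only [Nat.add_sub_cancel]
      rw [hermite_succ n]
      push_cast
      ring

theorem memLp_pow_mul_gaussian (k : ℕ) :
    MemLp (fun x : ℝ => x ^ k * Real.exp (-(x ^ 2) / 4)) 2 volume := by
  rw [memLp_two_iff_integrable_sq (by fun_prop)]
  have h := integrable_rpow_mul_exp_neg_mul_sq (b := 1 / 2) (by norm_num) (s := (2 * k : ℕ))
    (lt_of_lt_of_le (by norm_num) (Nat.cast_nonneg _))
  refine h.congr (Eventually.of_forall fun x => ?_)
  simp only [Real.rpow_natCast]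
  rw [mul_pow, ← pow_mul, ← Real.exp_nat_mul, mul_comm k 2]
  congr 2
  push_cast
  ring

theorem memLp_polynomial_mul_gaussian (p : Polynomial ℤ) :
    MemLp (fun x : ℝ => Polynomial.aeval x p * Real.exp (-(x ^ 2) / 4)) 2 volume := by
  have h : (fun x : ℝ => Polynomial.aeval x p * Real.exp (-(x ^ 2) / 4))
      = fun x => ∑ i ∈ Finset.range (p.natDegree + 1),
        (p.coeff i : ℝ) * (x ^ i * Real.exp (-(x ^ 2) / 4)) := by
    funext x
    rw [Polynomial.aeval_eq_sum_range, Finset.sum_mul]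
    refine Finset.sum_congr rfl fun i _ => ?_
    rw [zsmul_eq_mul, mul_assoc]
  rw [h]
  exact memLp_finsetSum _ fun i _ => (memLp_pow_mul_gaussian i).const_mul _

theorem memLp_hermiteFun (n : ℕ) : MemLp (hermiteFun n) 2 volume := by
  have h := (memLp_polynomial_mul_gaussian (Polynomial.hermite n)).const_mul
    (Real.sqrt (n.factorial * Real.sqrt (2 * Real.pi)))⁻¹
  convert h using 2 with x
  rw [hermiteFun, div_eq_inv_mul]

theorem memLp_pow_mul_hermiteFun (k n : ℕ) :
    MemLp (fun x => x ^ k * hermiteFun n x) 2 volume := by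
  have h := (memLp_polynomial_mul_gaussian (Polynomial.X ^ k * Polynomial.hermite n)).const_mul
    (Real.sqrt (n.factorial * Real.sqrt (2 * Real.pi)))⁻¹
  convert h using 2 with x
  simp only [hermiteFun, div_eq_inv_mul, map_mul, map_pow, Polynomial.aeval_X]
  ring

theorem hermiteFun_norm_succ (n : ℕ) :
    Real.sqrt ((n + 1).factorial * Real.sqrt (2 * Real.pi))
      = Real.sqrt (n + 1) * Real.sqrt (n.factorial * Real.sqrt (2 * Real.pi)) := by
  rw [← Real.sqrt_mul (by positivity), Nat.factorial_succ]
  push_cast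
  rw [mul_assoc]

theorem hermiteFun_norm_pos (n : ℕ) :
    0 < Real.sqrt (n.factorial * Real.sqrt (2 * Real.pi)) := by
  have := Nat.factorial_pos n
  have := Real.pi_pos
  positivity

/-- Expresses the lowered function with the normalising constant of index n. Here and below the
truncated `n - 1` at n = 0 is harmless, since its coefficient √n vanishes. -/
theorem sqrt_mul_hermiteFun_pred (n : ℕ) (x : ℝ) :
    Real.sqrt n * hermiteFun (n - 1) x
      = n * Polynomial.aeval x (Polynomial.hermite (n - 1)) * Real.exp (-(x ^ 2) / 4)
        / Real.sqrt (n.factorial * Real.sqrt (2 * Real.pi)) := by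
  cases n with
  | zero => simp
  | succ n =>
    have h := hermiteFun_norm_pos n
    have h1 : 0 < Real.sqrt ((n : ℝ) + 1) := by positivity
    have h2 : Real.sqrt ((n : ℝ) + 1) ^ 2 = n + 1 := Real.sq_sqrt (by positivity)
    rw [hermiteFun_norm_succ, hermiteFun, Nat.add_sub_cancel]
    push_cast
    field_simp
    rw [h2]

theorem sqrt_mul_hermiteFun_succ (n : ℕ) (x : ℝ) :
    Real.sqrt (n + 1) * hermiteFun (n + 1) x
      = Polynomial.aeval x (Polynomial.hermite (n + 1)) * Real.exp (-(x ^ 2) / 4)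
        / Real.sqrt (n.factorial * Real.sqrt (2 * Real.pi)) := by
  have h := hermiteFun_norm_pos n
  have h1 : 0 < Real.sqrt ((n : ℝ) + 1) := by positivity
  rw [hermiteFun, hermiteFun_norm_succ]
  field_simp

theorem aeval_hermite_succ (n : ℕ) (x : ℝ) :
    Polynomial.aeval x (Polynomial.hermite (n + 1))
      = x * Polynomial.aeval x (Polynomial.hermite n)
        - n * Polynomial.aeval x (Polynomial.hermite (n - 1)) := by
  rw [Polynomial.hermite_succ, derivative_hermite]
  simp

/-- Multiplication by `x` in terms of the ladder. -/
theorem mul_hermiteFun (n : ℕ) (x : ℝ) :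
    x * hermiteFun n x
      = Real.sqrt (n + 1) * hermiteFun (n + 1) x + Real.sqrt n * hermiteFun (n - 1) x := by
  rw [sqrt_mul_hermiteFun_pred, sqrt_mul_hermiteFun_succ, hermiteFun, aeval_hermite_succ]
  ring

/-- Differentiation in terms of the ladder. -/
theorem hasDerivAt_hermiteFun (n : ℕ) (x : ℝ) :
    HasDerivAt (hermiteFun n)
      ((Real.sqrt n * hermiteFun (n - 1) x - Real.sqrt (n + 1) * hermiteFun (n + 1) x) / 2) x := by
  have h1 := Polynomial.hasDerivAt_aeval (Polynomial.hermite n) x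
  have h2 : HasDerivAt (fun x : ℝ => Real.exp (-(x ^ 2) / 4))
      (Real.exp (-(x ^ 2) / 4) * (-(2 * x) / 4)) x := by
    have := (((hasDerivAt_pow 2 x).neg).div_const 4).exp
    simpa using this
  have h3 := (h1.mul h2).div_const (Real.sqrt (n.factorial * Real.sqrt (2 * Real.pi)))
  refine h3.congr_deriv ?_
  rw [sqrt_mul_hermiteFun_pred, sqrt_mul_hermiteFun_succ, aeval_hermite_succ,
    derivative_hermite]
  simp only [map_mul, map_natCast]
  ring

theorem continuous_hermiteFun (n : ℕ) : Continuous (hermiteFun n) :=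
  continuous_iff_continuousAt.2 fun x => (hasDerivAt_hermiteFun n x).continuousAt

theorem integrable_hermiteFun_mul (n : ℕ) {f : ℝ → ℝ} (hf : MemLp f 2 volume) :
    Integrable (fun x => hermiteFun n x * f x) :=
  (memLp_hermiteFun n).integrable_mul hf

/-- Raising x/2 - ∂ₓ and lowering x/2 + ∂ₓ are adjoint: combine integration by parts with the
symmetry of multiplication by x. -/
theorem integral_hermiteFun_ladder (m n : ℕ) :
    Real.sqrt (m + 1) * ∫ x, hermiteFun (m + 1) x * hermiteFun n x
      = Real.sqrt n * ∫ x, hermiteFun m x * hermiteFun (n - 1) x := by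
  have hi : ∀ m n, Integrable (fun x => hermiteFun m x * hermiteFun n x) := fun m n =>
    integrable_hermiteFun_mul m (memLp_hermiteFun n)
  have hip := integral_mul_deriv_eq_deriv_mul_of_integrable
    (fun x _ => hasDerivAt_hermiteFun m x) (fun x _ => hasDerivAt_hermiteFun n x)
    (by
      refine (((hi m (n - 1)).const_mul (Real.sqrt n / 2)).sub
        ((hi m (n + 1)).const_mul (Real.sqrt (n + 1) / 2))).congr (Eventually.of_forall fun x => ?_)
      simp only [Pi.sub_apply, Pi.mul_apply]
      ring)
    (by
      refine (((hi (m - 1) n).const_mul (Real.sqrt m / 2)).sub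
        ((hi (m + 1) n).const_mul (Real.sqrt (m + 1) / 2))).congr (Eventually.of_forall fun x => ?_)
      simp only [Pi.sub_apply, Pi.mul_apply]
      ring)
    (hi m n)
  have hx : ∫ x, (Real.sqrt (n + 1) * (hermiteFun m x * hermiteFun (n + 1) x)
        + Real.sqrt n * (hermiteFun m x * hermiteFun (n - 1) x))
      = ∫ x, (Real.sqrt (m + 1) * (hermiteFun (m + 1) x * hermiteFun n x)
        + Real.sqrt m * (hermiteFun (m - 1) x * hermiteFun n x)) := by
    refine integral_congr_ae (Eventually.of_forall fun x => ?_)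
    have h1 := mul_hermiteFun m x
    have h2 := mul_hermiteFun n x
    simp only
    linear_combination hermiteFun n x * h1 - hermiteFun m x * h2
  have e1 : ∫ x, hermiteFun m x * ((Real.sqrt n * hermiteFun (n - 1) x
        - Real.sqrt (n + 1) * hermiteFun (n + 1) x) / 2)
      = ∫ x, (Real.sqrt n / 2 * (hermiteFun m x * hermiteFun (n - 1) x)
        - Real.sqrt (n + 1) / 2 * (hermiteFun m x * hermiteFun (n + 1) x)) := by
    congr 1; funext x; ring
  have e2 : ∫ x, ((Real.sqrt m * hermiteFun (m - 1) x
        - Real.sqrt (m + 1) * hermiteFun (m + 1) x) / 2) * hermiteFun n x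
      = ∫ x, (Real.sqrt m / 2 * (hermiteFun (m - 1) x * hermiteFun n x)
        - Real.sqrt (m + 1) / 2 * (hermiteFun (m + 1) x * hermiteFun n x)) := by
    congr 1; funext x; ring
  rw [e1, e2, integral_sub ((hi _ _).const_mul _) ((hi _ _).const_mul _),
    integral_sub ((hi _ _).const_mul _) ((hi _ _).const_mul _)] at hip
  rw [integral_add ((hi _ _).const_mul _) ((hi _ _).const_mul _),
    integral_add ((hi _ _).const_mul _) ((hi _ _).const_mul _)] at hx
  simp only [integral_const_mul] at hip hx
  linarith

theorem integral_hermiteFun_zero : ∫ x, hermiteFun 0 x * hermiteFun 0 x = 1 := by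
  have h : (fun x => hermiteFun 0 x * hermiteFun 0 x)
      = fun x => (Real.sqrt (2 * Real.pi))⁻¹ * Real.exp (-(1 / 2) * x ^ 2) := by
    funext x
    have h1 : Real.exp (-(x ^ 2) / 4) * Real.exp (-(x ^ 2) / 4) = Real.exp (-(1 / 2) * x ^ 2) := by
      rw [← Real.exp_add]
      congr 1
      ring
    have h2 : Real.sqrt (Real.sqrt (2 * Real.pi)) ^ 2 = Real.sqrt (2 * Real.pi) :=
      Real.sq_sqrt (Real.sqrt_nonneg _)
    simp only [hermiteFun, Polynomial.hermite_zero, map_one, one_mul, Nat.factorial_zero,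
      Nat.cast_one]
    rw [← h1]
    conv_rhs => rw [← h2]
    have := hermiteFun_norm_pos 0
    simp only [Nat.factorial_zero, Nat.cast_one, one_mul] at this
    field_simp
  rw [h, integral_const_mul, integral_gaussian]
  have : Real.pi / (1 / 2) = 2 * Real.pi := by ring
  rw [this]
  have : 0 < Real.sqrt (2 * Real.pi) := by
    have := Real.pi_pos
    positivity
  field_simp

theorem integral_hermiteFun_mul (m n : ℕ) :
    ∫ x, hermiteFun m x * hermiteFun n x = if m = n then 1 else 0 := by
  have h0 : ∀ m, ∫ x, hermiteFun (m + 1) x * hermiteFun 0 x = 0 := fun m => by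
    have h := integral_hermiteFun_ladder m 0
    simp only [Nat.cast_zero, Real.sqrt_zero, zero_mul] at h
    exact (mul_eq_zero.1 h).resolve_left (by positivity)
  induction m generalizing n with
  | zero =>
    cases n with
    | zero => simpa using integral_hermiteFun_zero
    | succ n =>
      simp only [mul_comm (hermiteFun 0 _), h0]
      simp
  | succ m ih =>
    cases n with
    | zero => simp [h0]
    | succ n =>
      have h := integral_hermiteFun_ladder m (n + 1)
      rw [Nat.add_sub_cancel, ih] at h
      have hm : Real.sqrt ((m : ℝ) + 1) ≠ 0 := by positivity
      by_cases hmn : m = n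
      · subst hmn
        simpa [hm] using h
      · simpa [hm, hmn] using h

/-- The Hermite functions as elements of `L²`. -/
noncomputable def hermiteLp (n : ℕ) : L2 := (memLp_hermiteFun n).toLp (hermiteFun n)

theorem inner_eq_integral (u w : L2) : inner ℝ u w = ∫ x, u x * w x := by
  rw [L2.inner_def]
  simp only [RCLike.inner_apply, conj_trivial, mul_comm]

theorem inner_toLp {f : ℝ → ℝ} (hf : MemLp f 2 volume) (u : L2) :
    inner ℝ (hf.toLp f) u = ∫ x, f x * u x := by
  rw [inner_eq_integral]
  refine integral_congr_ae ?_
  filter_upwards [hf.coeFn_toLp] with x hx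
  rw [hx]

theorem hermiteCoeff_eq_inner (u : L2) (n : ℕ) : hermiteCoeff u n = inner ℝ (hermiteLp n) u :=
  (inner_toLp _ u).symm

theorem orthonormal_hermiteLp : Orthonormal ℝ hermiteLp := by
  rw [orthonormal_iff_ite]
  intro m n
  rw [hermiteLp, inner_toLp, ← integral_hermiteFun_mul]
  refine integral_congr_ae ?_
  filter_upwards [(memLp_hermiteFun n).coeFn_toLp] with x hx
  rw [hermiteLp, hx]

/-- An integrable function with vanishing Fourier transform vanishes. -/
theorem ae_eq_zero_of_fourier_eq_zero {g : ℝ → ℝ} (hg : Integrable g)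
    (h : ∀ t : ℝ, ∫ x : ℝ, Complex.exp (t * x * Complex.I) * (g x : ℂ) = 0) : g =ᵐ[volume] 0 := by
  -- The positive and negative parts of g are densities of finite measures with the same
  -- characteristic function, hence of the same measure.
  have hfin1 : IsFiniteMeasure (volume.withDensity fun x => ENNReal.ofReal (g x)) :=
    isFiniteMeasure_withDensity_ofReal hg.2
  have hfin2 : IsFiniteMeasure (volume.withDensity fun x => ENNReal.ofReal (-g x)) :=
    isFiniteMeasure_withDensity_ofReal hg.neg.2
  have hint : ∀ f : ℝ → ℝ, Integrable f → ∀ t : ℝ,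
      Integrable fun x : ℝ => (max (f x) 0) • Complex.exp (t * x * Complex.I) := by
    intro f hf t
    have h1 : Integrable fun x => ((max (f x) 0 : ℝ) : ℂ) := hf.pos_part.ofReal
    have h2 := h1.bdd_mul (c := 1) (f := fun x : ℝ => Complex.exp (t * x * Complex.I))
      (by fun_prop) (Eventually.of_forall fun x => by
        rw [← Complex.ofReal_mul, Complex.norm_exp_ofReal_mul_I])
    refine h2.congr (Eventually.of_forall fun x => ?_)
    simp only [Complex.real_smul]
    ring
  have heq : (volume.withDensity fun x => ENNReal.ofReal (g x))
      = volume.withDensity fun x => ENNReal.ofReal (-g x) := by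
    refine Measure.ext_of_charFun (funext fun t => ?_)
    rw [charFun_apply_real, charFun_apply_real,
      integral_withDensity_eq_integral_toReal_smul₀ hg.1.aemeasurable.ennreal_ofReal (by simp),
      integral_withDensity_eq_integral_toReal_smul₀ (f := fun x => ENNReal.ofReal (-g x))
        hg.1.aemeasurable.neg.ennreal_ofReal (by simp),
      ← sub_eq_zero]
    simp only [ENNReal.toReal_ofReal']
    rw [← integral_sub (hint g hg t) (hint (fun x => -g x) hg.neg t), ← h t]
    refine integral_congr_ae (Eventually.of_forall fun x => ?_)
    simp only [Complex.real_smul]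
    rw [← sub_mul, mul_comm, ← Complex.ofReal_sub]
    congr 2
    rcases le_total (g x) 0 with hx | hx
    · rw [max_eq_right hx, max_eq_left (by linarith)]; ring
    · rw [max_eq_left hx, max_eq_right (by linarith)]; ring
  have h1 := (withDensity_eq_iff hg.1.aemeasurable.ennreal_ofReal
    hg.1.aemeasurable.neg.ennreal_ofReal
    (by simpa using (measure_lt_top (volume.withDensity fun x => ENNReal.ofReal (g x)) univ).ne)).1
    heq
  filter_upwards [h1] with x hx
  have h2 := congrArg ENNReal.toReal hx
  simp only [Pi.neg_apply, ENNReal.toReal_ofReal'] at h2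
  rcases le_total (g x) 0 with hx | hx
  · rw [max_eq_right hx, max_eq_left (by linarith)] at h2
    simp only [Pi.zero_apply]; linarith
  · rw [max_eq_left hx, max_eq_right (by linarith)] at h2
    simp only [Pi.zero_apply]; linarith

/-- Supplies the dominating function when e^{itx} is expanded in its power series. The bound
completes the square (2|t| - |x|/2)². -/
theorem memLp_exp_mul_gaussian (t : ℝ) :
    MemLp (fun x : ℝ => Real.exp |t * x| * Real.exp (-(x ^ 2) / 4)) 2 volume := by
  rw [memLp_two_iff_integrable_sq (by fun_prop)]
  have h := (integrable_exp_neg_mul_sq (b := 1 / 4) (by norm_num)).const_mul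
    (Real.exp (4 * t ^ 2))
  refine h.mono' (by fun_prop) (Eventually.of_forall fun x => ?_)
  rw [Real.norm_eq_abs, abs_of_nonneg (by positivity), ← Real.exp_add, ← Real.exp_add,
    ← Real.exp_nat_mul]
  refine Real.exp_le_exp.2 ?_
  push_cast
  rw [abs_mul]
  nlinarith [sq_nonneg (2 * |t| - |x| / 2), sq_abs t, sq_abs x]

/-- The Hermite functions are complete. -/
theorem eq_zero_of_hermiteCoeff_eq_zero {u : L2} (hu : ∀ n, hermiteCoeff u n = 0) : u = 0 := by
  have hmem : MemLp (u : ℝ → ℝ) 2 volume := Lp.memLp u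
  have hint : ∀ k n, Integrable fun x => x ^ k * hermiteFun n x * u x := fun k n =>
    (memLp_pow_mul_hermiteFun k n).integrable_mul hmem
  -- Each power of x is absorbed by the ladder relation, so all moments of the Gaussian times u
  -- vanish. Its Fourier transform then vanishes term by term.
  have hmom : ∀ k n, ∫ x, x ^ k * hermiteFun n x * u x = 0 := by
    intro k
    induction k with
    | zero => intro n; simpa [hermiteCoeff] using hu n
    | succ k ih =>
      intro n
      have h : (fun x => x ^ (k + 1) * hermiteFun n x * u x)
          = fun x => Real.sqrt (n + 1) * (x ^ k * hermiteFun (n + 1) x * u x)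
            + Real.sqrt n * (x ^ k * hermiteFun (n - 1) x * u x) := by
        funext x
        linear_combination (x ^ k * u x) * mul_hermiteFun n x
      rw [h, integral_add ((hint _ _).const_mul _) ((hint _ _).const_mul _), integral_const_mul,
        integral_const_mul, ih, ih, mul_zero, mul_zero, add_zero]
  set g : ℝ → ℝ := fun x => Real.exp (-(x ^ 2) / 4) * u x with hg
  have hgi : ∀ k : ℕ, Integrable fun x => x ^ k * g x := fun k => by
    have := (memLp_pow_mul_gaussian k).integrable_mul hmem
    refine this.congr (Eventually.of_forall fun x => ?_)
    simp only [Pi.mul_apply, hg]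
    ring
  have hgm : ∀ k : ℕ, ∫ x, x ^ k * g x = 0 := fun k => by
    have h := hmom k 0
    have h1 : (fun x => x ^ k * hermiteFun 0 x * u x)
        = fun x => (Real.sqrt ((0 : ℕ).factorial * Real.sqrt (2 * Real.pi)))⁻¹ * (x ^ k * g x) := by
      funext x
      simp only [hermiteFun, Polynomial.hermite_zero, map_one, one_mul, hg, div_eq_inv_mul]
      ring
    rw [h1, integral_const_mul] at h
    exact (mul_eq_zero.1 h).resolve_left (inv_ne_zero (hermiteFun_norm_pos 0).ne')
  have hg0 : Integrable g := by simpa using hgi 0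
  have hzero : g =ᵐ[volume] 0 := by
    refine ae_eq_zero_of_fourier_eq_zero hg0 fun t => ?_
    have hbound : Integrable fun x => Real.exp |t * x| * |g x| := by
      have h := ((memLp_exp_mul_gaussian t).integrable_mul hmem).abs
      refine h.congr (Eventually.of_forall fun x => ?_)
      simp only [Pi.mul_apply, hg, abs_mul, Real.abs_exp]
      ring
    have hlim := tendsto_integral_of_dominated_convergence (μ := volume)
      (F := fun N (x : ℝ) => (∑ k ∈ Finset.range N, ((t : ℂ) * x * Complex.I) ^ k / k.factorial)
        * (g x : ℂ)) (f := fun x : ℝ => Complex.exp (t * x * Complex.I) * (g x : ℂ)) _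
      (fun N => by
        refine AEStronglyMeasurable.mul (Continuous.aestronglyMeasurable (by fun_prop)) ?_
        exact Complex.continuous_ofReal.comp_aestronglyMeasurable hg0.1)
      hbound
      (fun N => Eventually.of_forall fun x => by
        rw [norm_mul, Complex.norm_real, Real.norm_eq_abs]
        refine mul_le_mul_of_nonneg_right ?_ (abs_nonneg _)
        refine le_trans ((norm_sum_le _ _).trans (le_of_eq ?_))
          (Real.sum_le_exp_of_nonneg (abs_nonneg (t * x)) N)
        refine Finset.sum_congr rfl fun k _ => ?_
        rw [norm_div, norm_pow, norm_mul, Complex.norm_I, mul_one, ← Complex.ofReal_mul,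
          Complex.norm_real, Real.norm_eq_abs, Complex.norm_natCast])
      (Eventually.of_forall fun x => by
        refine Tendsto.mul_const _ ?_
        rw [Complex.exp_eq_exp_ℂ]
        exact (NormedSpace.expSeries_div_hasSum_exp _).tendsto_sum_nat)
    refine tendsto_nhds_unique hlim (tendsto_const_nhds.congr fun N => ?_)
    have h1 : ∀ k : ℕ, ∀ x : ℝ, ((t : ℂ) * x * Complex.I) ^ k / k.factorial * (g x : ℂ)
        = ((t : ℂ) * Complex.I) ^ k / k.factorial * ((x ^ k * g x : ℝ) : ℂ) := fun k x => by
      push_cast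
      ring
    simp only [Finset.sum_mul, h1]
    rw [integral_finsetSum _ fun k _ => ((hgi k).ofReal).const_mul _]
    symm
    refine Finset.sum_eq_zero fun k _ => ?_
    have h2 : ∫ x : ℝ, ((x ^ k * g x : ℝ) : ℂ) = ((∫ x : ℝ, x ^ k * g x : ℝ) : ℂ) := integral_ofReal
    rw [integral_const_mul, h2, hgm, Complex.ofReal_zero, mul_zero]
  rw [Lp.eq_zero_iff_ae_eq_zero]
  filter_upwards [hzero] with x hx
  exact (mul_eq_zero.1 hx).resolve_left (Real.exp_pos _).ne'

/-- The Hilbert basis of Hermite functions. -/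
noncomputable def hermiteBasis : HilbertBasis ℕ ℝ L2 :=
  HilbertBasis.mkOfOrthogonalEqBot orthonormal_hermiteLp (by
    rw [Submodule.eq_bot_iff]
    intro u hu
    refine eq_zero_of_hermiteCoeff_eq_zero fun n => ?_
    rw [hermiteCoeff_eq_inner]
    exact (Submodule.mem_orthogonal _ _).1 hu _ (Submodule.subset_span (mem_range_self n)))

theorem hermiteBasis_repr (u : L2) (n : ℕ) : hermiteBasis.repr u n = hermiteCoeff u n := by
  rw [HilbertBasis.repr_apply_apply, hermiteCoeff_eq_inner, hermiteBasis,
    HilbertBasis.coe_mkOfOrthogonalEqBot]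

end Hermite

/-! ### Hermite functions as admissible test functions -/

section TestFunctions

theorem IsTest.deriv {φ : ℝ → ℝ} (h : IsTest φ) : IsTest (deriv φ) :=
  ⟨(contDiff_infty_iff_deriv.1 h.1).2, h.2.deriv⟩

theorem IsTest.iteratedDeriv {φ : ℝ → ℝ} (h : IsTest φ) (i : ℕ) : IsTest (iteratedDeriv i φ) := by
  induction i with
  | zero => rwa [iteratedDeriv_zero]
  | succ i ih =>
    rw [iteratedDeriv_succ]
    exact ih.deriv

theorem IsTest.mul_left {φ ψ : ℝ → ℝ} (h : IsTest φ) (hψ : ContDiff ℝ ∞ ψ) :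
    IsTest (fun x => ψ x * φ x) :=
  ⟨hψ.mul h.1, h.2.mul_left⟩

theorem IsTest.add {φ ψ : ℝ → ℝ} (h : IsTest φ) (hψ : IsTest ψ) : IsTest (fun x => φ x + ψ x) :=
  ⟨h.1.add hψ.1, h.2.add hψ.2⟩

theorem IsTest.memLp {φ : ℝ → ℝ} (h : IsTest φ) : MemLp φ 2 volume :=
  h.1.continuous.memLp_of_hasCompactSupport h.2

theorem IsTest.hasDerivAt {φ : ℝ → ℝ} (h : IsTest φ) (x : ℝ) :
    HasDerivAt φ (_root_.deriv φ x) x :=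
  (h.1.differentiable (by simp) x).hasDerivAt

theorem schrodinger_eq (φ : ℝ → ℝ) : schrodinger φ
    = fun x => -1 * deriv (deriv φ) x + 1 / 4 * (x ^ 2 - 6) * φ x := by
  funext x
  rw [schrodinger, iteratedDeriv_succ, iteratedDeriv_one]
  ring

theorem IsTest.schrodinger {φ : ℝ → ℝ} (h : IsTest φ) : IsTest (schrodinger φ) := by
  rw [schrodinger_eq]
  exact (h.deriv.deriv.mul_left contDiff_const).add (h.mul_left (by fun_prop))

theorem contDiff_hermiteFun (n : ℕ) : ContDiff ℝ ∞ (hermiteFun n) := by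
  have h : ContDiff ℝ ∞ fun x : ℝ => Polynomial.aeval x (Polynomial.hermite n) :=
    Polynomial.contDiff_aeval _ _
  unfold hermiteFun
  fun_prop

theorem deriv_hermiteFun (n : ℕ) : deriv (hermiteFun n) = fun x =>
    (Real.sqrt n * hermiteFun (n - 1) x - Real.sqrt (n + 1) * hermiteFun (n + 1) x) / 2 :=
  funext fun x => (hasDerivAt_hermiteFun n x).deriv

theorem hasDerivAt_deriv_hermiteFun (n : ℕ) (x : ℝ) :
    HasDerivAt (deriv (hermiteFun n)) ((x ^ 2 / 4 - (n + 1 / 2)) * hermiteFun n x) x := by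
  rw [deriv_hermiteFun]
  refine (((hasDerivAt_hermiteFun (n - 1) x).const_mul (Real.sqrt n)).sub
    ((hasDerivAt_hermiteFun (n + 1) x).const_mul (Real.sqrt (n + 1)))).div_const 2 |>.congr_deriv ?_
  have h1 : Real.sqrt ((n : ℝ) + 1) ^ 2 = n + 1 := Real.sq_sqrt (by positivity)
  have m0 := mul_hermiteFun n x
  have m1 := mul_hermiteFun (n + 1) x
  cases n with
  | zero =>
    simp only [Nat.cast_zero, Real.sqrt_zero, zero_mul, zero_add, Nat.cast_one, Nat.zero_sub,
      add_zero, Nat.sub_self, Real.sqrt_one, one_mul] at *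
    linear_combination (-x / 4) * m0 - m1 / 4
  | succ n =>
    have m2 := mul_hermiteFun n x
    have h2 : Real.sqrt ((n : ℝ) + 1) ^ 2 = n + 1 := Real.sq_sqrt (by positivity)
    simp only [Nat.add_sub_cancel] at *
    push_cast at *
    linear_combination (-x / 4) * m0 - Real.sqrt (n + 1 + 1) / 4 * m1
      - Real.sqrt (n + 1) / 4 * m2 - hermiteFun (n + 1) x / 2 * (h1 + h2)

/-- Commuting gives L∂ₓu_n = ∂ₓLu_n - (x/2)u_n = (n-1)u_n' - (x/2)u_n, and the ladder relations do
the rest. -/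
theorem schrodinger_deriv_hermiteFun (n : ℕ) (x : ℝ) : schrodinger (deriv (hermiteFun n)) x
    = (Real.sqrt n * (n - 2) * hermiteFun (n - 1) x
      - Real.sqrt (n + 1) * n * hermiteFun (n + 1) x) / 2 := by
  have h2 : deriv (deriv (hermiteFun n)) = fun x => (x ^ 2 / 4 - (n + 1 / 2)) * hermiteFun n x :=
    funext fun x => (hasDerivAt_deriv_hermiteFun n x).deriv
  have h3 : HasDerivAt (fun x => (x ^ 2 / 4 - (n + 1 / 2)) * hermiteFun n x)
      (x / 2 * hermiteFun n x + (x ^ 2 / 4 - (n + 1 / 2)) * deriv (hermiteFun n) x) x := by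
    have := ((((hasDerivAt_pow 2 x).div_const 4).sub_const ((n : ℝ) + 1 / 2))).mul
      (hasDerivAt_hermiteFun n x)
    refine this.congr_deriv ?_
    rw [deriv_hermiteFun]
    push_cast
    ring
  rw [schrodinger_eq, h2]
  simp only [h3.deriv, deriv_hermiteFun]
  linear_combination (-1 / 2) * mul_hermiteFun n x

theorem memLp_pow_mul_iteratedDeriv_hermiteFun (k i n : ℕ) :
    MemLp (fun x => x ^ k * iteratedDeriv i (hermiteFun n) x) 2 volume := by
  induction i generalizing n with
  | zero => simpa using memLp_pow_mul_hermiteFun k n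
  | succ i ih =>
    have hc : ∀ m, ContDiff ℝ i (hermiteFun m) := fun m => (contDiff_hermiteFun m).of_le
      (mod_cast le_top)
    have h : iteratedDeriv (i + 1) (hermiteFun n) = fun x =>
        Real.sqrt n / 2 * iteratedDeriv i (hermiteFun (n - 1)) x
          + -Real.sqrt (n + 1) / 2 * iteratedDeriv i (hermiteFun (n + 1)) x := by
      rw [iteratedDeriv_succ', deriv_hermiteFun]
      funext x
      have e : (fun x => (Real.sqrt n * hermiteFun (n - 1) x
          - Real.sqrt (n + 1) * hermiteFun (n + 1) x) / 2)
          = fun x => Real.sqrt n / 2 * hermiteFun (n - 1) x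
            + -Real.sqrt (n + 1) / 2 * hermiteFun (n + 1) x := by
        funext x; ring
      rw [e, iteratedDeriv_fun_add (contDiff_const.mul (hc _)).contDiffAt
        (contDiff_const.mul (hc _)).contDiffAt, iteratedDeriv_const_mul_field,
        iteratedDeriv_const_mul_field]
    rw [h]
    refine (((ih (n - 1)).const_mul (Real.sqrt n / 2)).add
      ((ih (n + 1)).const_mul (-Real.sqrt (n + 1) / 2))).congr_norm ?_ ?_
    · refine (((ih (n - 1)).1.const_mul (Real.sqrt n / 2)).add
        ((ih (n + 1)).1.const_mul (-Real.sqrt (n + 1) / 2))).congr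
          (Eventually.of_forall fun x => ?_)
      simp only [Pi.add_apply]
      ring
    · refine Eventually.of_forall fun x => ?_
      simp only [Pi.add_apply]
      congr 1
      ring

/-- A fixed smooth cutoff function. -/
noncomputable def cutoff : ℝ → ℝ := (⟨1, 2, one_pos, one_lt_two⟩ : ContDiffBump (0 : ℝ))

theorem isTest_cutoff : IsTest cutoff :=
  ⟨ContDiffBump.contDiff _, ContDiffBump.hasCompactSupport _⟩

theorem cutoff_zero : cutoff 0 = 1 :=
  ContDiffBump.one_of_mem_closedBall _ (Metric.mem_closedBall_self zero_le_one)

theorem isTest_cutoff_mul {ψ : ℝ → ℝ} (hψ : ContDiff ℝ ∞ ψ) {ε : ℝ} (hε : ε ≠ 0) :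
    IsTest fun x => cutoff (ε * x) * ψ x := by
  refine ⟨(isTest_cutoff.1.comp (contDiff_const.mul contDiff_id)).mul hψ, ?_⟩
  exact (isTest_cutoff.2.comp_homeomorph (Homeomorph.mulLeft₀ ε hε)).mul_right

theorem iteratedDeriv_cutoff_mul {ψ : ℝ → ℝ} (hψ : ContDiff ℝ ∞ ψ) (ε x : ℝ) (j : ℕ) :
    iteratedDeriv j (fun x => cutoff (ε * x) * ψ x) x
      = ∑ i ∈ Finset.range (j + 1), (j.choose i : ℝ) * (ε ^ i * iteratedDeriv i cutoff (ε * x))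
        * iteratedDeriv (j - i) ψ x := by
  have h1 : ContDiff ℝ j fun x => cutoff (ε * x) :=
    (isTest_cutoff.1.comp (contDiff_const.mul contDiff_id)).of_le (mod_cast le_top)
  rw [iteratedDeriv_fun_mul h1.contDiffAt (hψ.of_le (mod_cast le_top)).contDiffAt]
  refine Finset.sum_congr rfl fun i _ => ?_
  rw [iteratedDeriv_comp_const_mul (isTest_cutoff.1.of_le (mod_cast le_top))]

theorem tendsto_iteratedDeriv_cutoff_mul {ψ : ℝ → ℝ} (hψ : ContDiff ℝ ∞ ψ) (x : ℝ) (j : ℕ) :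
    Tendsto (fun ε => iteratedDeriv j (fun x => cutoff (ε * x) * ψ x) x) (𝓝 0)
      (𝓝 (iteratedDeriv j ψ x)) := by
  have h0 : iteratedDeriv j ψ x = iteratedDeriv j (fun x => cutoff (0 * x) * ψ x) x := by
    simp only [zero_mul, cutoff_zero, one_mul]
  rw [h0]
  simp only [iteratedDeriv_cutoff_mul hψ]
  refine Continuous.tendsto (continuous_finsetSum _ fun i _ => ?_) 0
  have : Continuous (iteratedDeriv i cutoff) := (isTest_cutoff.iteratedDeriv i).1.continuous
  fun_prop

/-- By Leibniz, derivatives falling on the cutoff carry powers of ε ≤ 1 and bounded factors, so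
dominated convergence applies. Distributional identities thus extend from compactly supported tests
to Hermite functions. -/
theorem tendsto_integral_cutoff_mul {ψ : ℝ → ℝ} (hψ : ContDiff ℝ ∞ ψ)
    (hd : ∀ k i, MemLp (fun x => x ^ k * iteratedDeriv i ψ x) 2 volume) {u : ℝ → ℝ}
    (hu : MemLp u 2 volume) (k j : ℕ) :
    Tendsto (fun m : ℕ => ∫ x, u x *
      (x ^ k * iteratedDeriv j (fun x => cutoff (1 / ((m : ℝ) + 1) * x) * ψ x) x)) atTop
      (𝓝 (∫ x, u x * (x ^ k * iteratedDeriv j ψ x))) := by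
  have hC : ∀ i, ∃ C, ∀ x, ‖iteratedDeriv i cutoff x‖ ≤ C := fun i =>
    (isTest_cutoff.iteratedDeriv i).2.exists_bound_of_continuous
      (isTest_cutoff.iteratedDeriv i).1.continuous
  choose C hC using hC
  have hC0 : ∀ i, 0 ≤ C i := fun i => (norm_nonneg _).trans (hC i 0)
  refine tendsto_integral_of_dominated_convergence
    (fun x => ∑ i ∈ Finset.range (j + 1),
      (j.choose i : ℝ) * C i * |u x * (x ^ k * iteratedDeriv (j - i) ψ x)|) (fun m => ?_) ?_
    (fun m => Eventually.of_forall fun x => ?_) (Eventually.of_forall fun x => ?_)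
  · have h := (isTest_cutoff_mul hψ (ε := 1 / ((m : ℝ) + 1)) (by positivity)).iteratedDeriv j
    exact hu.1.mul (((continuous_pow k).mul h.1.continuous).aestronglyMeasurable)
  · exact integrable_finsetSum _ fun i _ => ((hu.integrable_mul (hd k (j - i))).abs).const_mul _
  · rw [iteratedDeriv_cutoff_mul hψ, Finset.mul_sum, Finset.mul_sum]
    refine (norm_sum_le _ _).trans (Finset.sum_le_sum fun i _ => ?_)
    have h1 : |1 / ((m : ℝ) + 1)| ^ i ≤ 1 := by
      refine pow_le_one₀ (abs_nonneg _) ?_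
      rw [abs_of_nonneg (by positivity), div_le_one (by positivity)]
      linarith [(Nat.cast_nonneg m : (0 : ℝ) ≤ m)]
    have h2 := hC i (1 / ((m : ℝ) + 1) * x)
    rw [Real.norm_eq_abs] at h2
    have h3 : ‖u x * (x ^ k * ((j.choose i : ℝ) * ((1 / ((m : ℝ) + 1)) ^ i
        * iteratedDeriv i cutoff (1 / ((m : ℝ) + 1) * x)) * iteratedDeriv (j - i) ψ x))‖
        = (j.choose i : ℝ) * (|1 / ((m : ℝ) + 1)| ^ i
          * |iteratedDeriv i cutoff (1 / ((m : ℝ) + 1) * x)|)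
          * |u x * (x ^ k * iteratedDeriv (j - i) ψ x)| := by
      rw [Real.norm_eq_abs]
      simp only [abs_mul, abs_pow, Nat.abs_cast]
      ring
    rw [h3]
    refine mul_le_mul_of_nonneg_right (mul_le_mul_of_nonneg_left ?_ (Nat.cast_nonneg _))
      (abs_nonneg _)
    calc _ ≤ 1 * C i := mul_le_mul h1 h2 (abs_nonneg _) zero_le_one
      _ = C i := one_mul _
  · refine Tendsto.const_mul _ (Tendsto.const_mul _ ?_)
    exact (tendsto_iteratedDeriv_cutoff_mul hψ x j).comp tendsto_one_div_add_atTop_nhds_zero_nat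

theorem HasWeakDeriv.hermiteCoeff_eq {u g : L2} (h : HasWeakDeriv u g) (n : ℕ) :
    hermiteCoeff g n = (Real.sqrt (n + 1) * hermiteCoeff u (n + 1)
      - Real.sqrt n * hermiteCoeff u (n - 1)) / 2 := by
  have hψ := contDiff_hermiteFun n
  have hd := fun k i => memLp_pow_mul_iteratedDeriv_hermiteFun k i n
  have h1 := tendsto_integral_cutoff_mul hψ hd (Lp.memLp u) 0 1
  have h2 := (tendsto_integral_cutoff_mul hψ hd (Lp.memLp g) 0 0).neg
  simp only [pow_zero, one_mul, iteratedDeriv_one, iteratedDeriv_zero] at h1 h2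
  have h3 := tendsto_nhds_unique (h1.congr fun m : ℕ =>
    h _ (isTest_cutoff_mul hψ (ε := 1 / ((m : ℝ) + 1)) (by positivity))) h2
  have hi := fun m => (integrable_hermiteFun_mul m (Lp.memLp u))
  have h4 : ∫ x, u x * deriv (hermiteFun n) x
      = (Real.sqrt n * hermiteCoeff u (n - 1) - Real.sqrt (n + 1) * hermiteCoeff u (n + 1)) / 2 := by
    simp only [hermiteCoeff, deriv_hermiteFun]
    rw [← integral_const_mul, ← integral_const_mul, ← integral_sub ((hi _).const_mul _)
      ((hi _).const_mul _), ← integral_div]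
    congr 1
    funext x
    ring
  have h5 : hermiteCoeff g n = ∫ x, g x * hermiteFun n x := by
    simp only [hermiteCoeff, mul_comm]
  rw [h5]
  linarith

theorem IsDxL.hermiteCoeff_eq {u w : L2} (h : IsDxL u w) (n : ℕ) :
    hermiteCoeff w n = (n * Real.sqrt (n + 1) * hermiteCoeff u (n + 1)
      - (n - 2) * Real.sqrt n * hermiteCoeff u (n - 1)) / 2 := by
  have hψ := contDiff_hermiteFun n
  have hd := fun k i => memLp_pow_mul_iteratedDeriv_hermiteFun k i n
  have hs : ∀ φ : ℝ → ℝ, (∀ k i, MemLp (fun x => x ^ k * iteratedDeriv i φ x) 2 volume) →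
      ∫ x, u x * schrodinger (deriv φ) x
        = -(∫ x, u x * (x ^ 0 * iteratedDeriv 3 φ x))
          + 1 / 4 * (∫ x, u x * (x ^ 2 * iteratedDeriv 1 φ x))
          - 3 / 2 * (∫ x, u x * (x ^ 0 * iteratedDeriv 1 φ x)) := by
    intro φ hφ
    have hi : ∀ k i, Integrable fun x => u x * (x ^ k * iteratedDeriv i φ x) := fun k i =>
      (Lp.memLp u).integrable_mul (hφ k i)
    have he : (fun x => u x * schrodinger (deriv φ) x) = fun x =>
        -(u x * (x ^ 0 * iteratedDeriv 3 φ x)) + 1 / 4 * (u x * (x ^ 2 * iteratedDeriv 1 φ x))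
          - 3 / 2 * (u x * (x ^ 0 * iteratedDeriv 1 φ x)) := by
      funext x
      rw [schrodinger, ← iteratedDeriv_succ', ← iteratedDeriv_one]
      ring
    have h3 : Integrable fun x => -(u x * (x ^ 0 * iteratedDeriv 3 φ x)) := (hi 0 3).neg
    have h4 : Integrable fun x => -(u x * (x ^ 0 * iteratedDeriv 3 φ x))
        + 1 / 4 * (u x * (x ^ 2 * iteratedDeriv 1 φ x)) := h3.add ((hi 2 1).const_mul _)
    rw [he, integral_sub h4 ((hi 0 1).const_mul _),
      integral_add h3 ((hi 2 1).const_mul _), integral_const_mul, integral_const_mul, integral_neg]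
  have hφ : ∀ m : ℕ, ∀ k i, MemLp (fun x => x ^ k
      * iteratedDeriv i (fun x => cutoff (1 / ((m : ℝ) + 1) * x) * hermiteFun n x) x) 2 volume :=
    fun m k i => (((isTest_cutoff_mul hψ (ε := 1 / ((m : ℝ) + 1)) (by positivity)).iteratedDeriv
      i).mul_left (contDiff_id.pow k)).memLp
  have h1 := ((tendsto_integral_cutoff_mul hψ hd (Lp.memLp u) 0 3).neg.add
    ((tendsto_integral_cutoff_mul hψ hd (Lp.memLp u) 2 1).const_mul (1 / 4))).sub
    ((tendsto_integral_cutoff_mul hψ hd (Lp.memLp u) 0 1).const_mul (3 / 2))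
  rw [← hs _ hd] at h1
  have h2 := tendsto_integral_cutoff_mul hψ hd (Lp.memLp w) 0 0
  simp only [pow_zero, one_mul, iteratedDeriv_zero] at h2
  have h3 := tendsto_nhds_unique (h2.congr fun m => by
    rw [h _ (isTest_cutoff_mul hψ (ε := 1 / ((m : ℝ) + 1)) (by positivity)), hs _ (hφ m)]) h1.neg
  have hi := fun m => (integrable_hermiteFun_mul m (Lp.memLp u))
  have h4 : ∫ x, u x * schrodinger (deriv (hermiteFun n)) x
      = (Real.sqrt n * (n - 2) * hermiteCoeff u (n - 1)
        - Real.sqrt (n + 1) * n * hermiteCoeff u (n + 1)) / 2 := by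
    simp only [hermiteCoeff, schrodinger_deriv_hermiteFun]
    rw [← integral_const_mul, ← integral_const_mul, ← integral_sub ((hi _).const_mul _)
      ((hi _).const_mul _), ← integral_div]
    congr 1
    funext x
    ring
  have h5 : hermiteCoeff w n = ∫ x, w x * hermiteFun n x := by
    simp only [hermiteCoeff, mul_comm]
  rw [h5, h3, h4]
  ring

end TestFunctions

/-! ### The energy space and the distributional operator in coefficients -/

section EnergySpace

theorem summable_mul_of_sq {a b : ℕ → ℝ} (ha : Summable fun n => a n ^ 2)
    (hb : Summable fun n => b n ^ 2) : Summable fun n => a n * b n := by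
  refine Summable.of_norm_bounded (ha.add hb) fun n => ?_
  rw [Real.norm_eq_abs, abs_le]
  constructor <;> nlinarith [sq_nonneg (a n + b n), sq_nonneg (a n - b n)]

theorem hasSum_of_shift {F : ℕ → ℝ} (h0 : F 0 = 0) {a : ℝ} (h : HasSum (fun n => F (n + 1)) a) :
    HasSum F a := by
  have := (hasSum_nat_add_iff 1).1 h
  simpa [h0] using this

/-- Summation by parts for operators that shift the index by one. -/
theorem eq_of_hasSum_ladder {p q c t : ℕ → ℝ} (p0 : p 0 = 0) (q0 : q 0 = 0)
    (hp : Summable fun n => p (n + 1) * c (n + 1) * t n)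
    (hq : Summable fun n => q (n + 1) * c n * t (n + 1)) {S T : ℝ}
    (hS : HasSum (fun n => c n * (p n * t (n - 1) + q (n + 1) * t (n + 1))) S)
    (hT : HasSum (fun n => (p (n + 1) * c (n + 1) + q n * c (n - 1)) * t n) T) : S = T := by
  have h1 : HasSum (fun n => p n * c n * t (n - 1)) (∑' n, p (n + 1) * c (n + 1) * t n) :=
    hasSum_of_shift (by simp [p0]) hp.hasSum
  have h2 : HasSum (fun n => q n * c (n - 1) * t n) (∑' n, q (n + 1) * c n * t (n + 1)) :=
    hasSum_of_shift (by simp [q0]) hq.hasSum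
  have e1 := hS.unique ((h1.add hq.hasSum).congr_fun fun n => by ring)
  have e2 := hT.unique ((hp.hasSum.add h2).congr_fun fun n => by ring)
  rw [e1, e2]

theorem hasSum_hermiteCoeff_mul (u : L2) {f : ℝ → ℝ} (hf : MemLp f 2 volume) :
    HasSum (fun n => hermiteCoeff u n * ∫ x, hermiteFun n x * f x) (∫ x, u x * f x) := by
  have h := hermiteBasis.hasSum_inner_mul_inner u (hf.toLp f)
  rw [real_inner_comm, inner_toLp] at h
  simp only [hermiteBasis, HilbertBasis.coe_mkOfOrthogonalEqBot] at h
  have e1 : ∫ x, u x * f x = ∫ x, f x * u x := by simp only [mul_comm]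
  rw [e1]
  refine h.congr_fun fun n => ?_
  have e2 : inner ℝ (hermiteLp n) (hf.toLp f) = ∫ x, hermiteFun n x * f x := by
    rw [hermiteLp, inner_toLp]
    refine integral_congr_ae ?_
    filter_upwards [hf.coeFn_toLp] with x hx
    rw [hx]
  rw [real_inner_comm, ← hermiteCoeff_eq_inner, e2]

theorem hasSum_sq_integral {f : ℝ → ℝ} (hf : MemLp f 2 volume) :
    HasSum (fun n => (∫ x, hermiteFun n x * f x) ^ 2) (∫ x, f x ^ 2) := by
  have h := hasSum_hermiteCoeff_mul (hf.toLp f) hf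
  have e : ∀ g : ℝ → ℝ, ∫ x, g x * hf.toLp f x = ∫ x, g x * f x := fun g => by
    refine integral_congr_ae ?_
    filter_upwards [hf.coeFn_toLp] with x hx
    rw [hx]
  have e1 : ∫ x, hf.toLp f x * f x = ∫ x, f x ^ 2 := by
    refine integral_congr_ae ?_
    filter_upwards [hf.coeFn_toLp] with x hx
    rw [hx, sq]
  rw [e1] at h
  refine h.congr_fun fun n => ?_
  rw [hermiteCoeff, e, sq]

theorem hasSum_sq_hermiteCoeff (u : L2) :
    HasSum (fun n => hermiteCoeff u n ^ 2) (∫ x, u x ^ 2) :=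
  hasSum_sq_integral (Lp.memLp u)

theorem integral_hermiteFun_mul_id {f : ℝ → ℝ} (hf : MemLp f 2 volume) (n : ℕ) :
    ∫ x, hermiteFun n x * (x * f x)
      = Real.sqrt (n + 1) * (∫ x, hermiteFun (n + 1) x * f x)
        + Real.sqrt n * ∫ x, hermiteFun (n - 1) x * f x := by
  rw [← integral_const_mul, ← integral_const_mul,
    ← integral_add ((integrable_hermiteFun_mul _ hf).const_mul _)
      ((integrable_hermiteFun_mul _ hf).const_mul _)]
  congr 1
  funext x
  linear_combination f x * mul_hermiteFun n x

theorem IsTest.integral_mul_deriv {φ : ℝ → ℝ} (h : IsTest φ) {f f' : ℝ → ℝ}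
    (hf : ∀ x, HasDerivAt f (f' x) x) (hf' : Continuous f') :
    ∫ x, f x * _root_.deriv φ x = -∫ x, f' x * φ x := by
  have hc : Continuous f := continuous_iff_continuousAt.2 fun x => (hf x).continuousAt
  refine integral_mul_deriv_eq_deriv_mul_of_integrable (fun x _ => hf x)
    (fun x _ => h.hasDerivAt x) ?_ ?_ ?_
  · exact (hc.mul h.deriv.1.continuous).integrable_of_hasCompactSupport h.deriv.2.mul_left
  · exact (hf'.mul h.1.continuous).integrable_of_hasCompactSupport h.2.mul_left
  · exact (hc.mul h.1.continuous).integrable_of_hasCompactSupport h.2.mul_left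

theorem IsTest.integral_hermiteFun_mul_deriv {φ : ℝ → ℝ} (h : IsTest φ) (n : ℕ) :
    ∫ x, hermiteFun n x * _root_.deriv φ x
      = (Real.sqrt (n + 1) * (∫ x, hermiteFun (n + 1) x * φ x)
        - Real.sqrt n * ∫ x, hermiteFun (n - 1) x * φ x) / 2 := by
  have hc := continuous_hermiteFun
  rw [h.integral_mul_deriv (hasDerivAt_hermiteFun n) (by fun_prop), ← integral_const_mul,
    ← integral_const_mul, ← integral_sub ((integrable_hermiteFun_mul _ h.memLp).const_mul _)
      ((integrable_hermiteFun_mul _ h.memLp).const_mul _), ← integral_div, ← integral_neg]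
  congr 1
  funext x
  ring

theorem IsTest.integral_hermiteFun_mul_schrodinger {φ : ℝ → ℝ} (h : IsTest φ) (n : ℕ) :
    ∫ x, hermiteFun n x * LogKdV.schrodinger φ x = (n - 1) * ∫ x, hermiteFun n x * φ x := by
  have hc := continuous_hermiteFun n
  have hd : ∀ x, HasDerivAt (hermiteFun n) (_root_.deriv (hermiteFun n) x) x := fun x =>
    ((contDiff_hermiteFun n).differentiable (by simp) x).hasDerivAt
  have hdc : Continuous (_root_.deriv (hermiteFun n)) :=
    continuous_iff_continuousAt.2 fun x => (hasDerivAt_deriv_hermiteFun n x).continuousAt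
  have h1 : ∫ x, hermiteFun n x * _root_.deriv (_root_.deriv φ) x
      = ∫ x, ((x ^ 2 / 4 - (n + 1 / 2)) * hermiteFun n x) * φ x := by
    rw [h.deriv.integral_mul_deriv hd hdc,
      h.integral_mul_deriv (hasDerivAt_deriv_hermiteFun n) (by fun_prop), neg_neg]
  have hi1 : Integrable fun x => hermiteFun n x * (-1 * _root_.deriv (_root_.deriv φ) x) :=
    integrable_hermiteFun_mul n (h.deriv.deriv.mul_left contDiff_const).memLp
  have hi2 : Integrable fun x => hermiteFun n x * (1 / 4 * (x ^ 2 - 6) * φ x) :=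
    integrable_hermiteFun_mul n
      (h.mul_left (ψ := fun x => 1 / 4 * (x ^ 2 - 6)) (by fun_prop)).memLp
  have hi3 : Integrable fun x => ((x ^ 2 / 4 - (n + 1 / 2)) * hermiteFun n x) * φ x :=
    (Continuous.mul (by fun_prop) h.1.continuous).integrable_of_hasCompactSupport h.2.mul_left
  have e1 : ∫ x, hermiteFun n x * (-1 * _root_.deriv (_root_.deriv φ) x)
      = ∫ x, -(((x ^ 2 / 4 - (n + 1 / 2)) * hermiteFun n x) * φ x) := by
    rw [integral_neg, ← h1, ← integral_neg]
    congr 1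
    funext x
    ring
  have hi4 : Integrable fun x => -(((x ^ 2 / 4 - (n + 1 / 2)) * hermiteFun n x) * φ x) := hi3.neg
  rw [schrodinger_eq]
  simp only [mul_add]
  rw [integral_add hi1 hi2, e1, ← integral_add hi4 hi2, ← integral_const_mul]
  congr 1
  funext x
  ring

theorem memLp_mul_id_of_memL21 {u : L2} (h : MemL21 u) :
    MemLp (fun x : ℝ => x * u x) 2 volume := by
  refine MemLp.of_le h (by fun_prop) (Eventually.of_forall fun x => ?_)
  rw [norm_mul, norm_mul]
  refine mul_le_mul_of_nonneg_right ?_ (norm_nonneg _)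
  rw [Real.norm_eq_abs, Real.norm_eq_abs, abs_of_nonneg (Real.sqrt_nonneg _)]
  exact Real.abs_le_sqrt (by linarith [sq_nonneg x])

theorem memL21_of_memLp_mul_id {u : L2} (h : MemLp (fun x : ℝ => x * u x) 2 volume) :
    MemL21 u := by
  refine MemLp.of_le (h.norm.add (Lp.memLp u).norm) (by fun_prop)
    (Eventually.of_forall fun x => ?_)
  have h1 : Real.sqrt (1 + x ^ 2) ≤ |x| + 1 := by
    rw [Real.sqrt_le_left (by positivity)]
    nlinarith [abs_nonneg x, sq_abs x]
  simp only [Pi.add_apply, Real.norm_eq_abs, abs_mul, abs_of_nonneg (Real.sqrt_nonneg _)]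
  refine le_trans ?_ (le_abs_self _)
  nlinarith [mul_le_mul_of_nonneg_right h1 (abs_nonneg (u x))]

theorem hasWeakDeriv_weakDeriv {u : L2} (h : MemH1 u) : HasWeakDeriv u (weakDeriv u) := by
  rw [weakDeriv, dif_pos h]
  exact h.choose_spec

/-- The integrals in the energy space in terms of Hermite coefficients. -/
theorem hasSum_energy {u : L2} (h1 : MemH1 u) (h2 : MemL21 u) :
    ∃ S, HasSum (fun n : ℕ => n * hermiteCoeff u n ^ 2) S ∧
      (∫ x, weakDeriv u x ^ 2) + 1 / 4 * (∫ x, (x * u x) ^ 2) = S + (∫ x, u x ^ 2) / 2 := by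
  have hx := memLp_mul_id_of_memL21 h2
  have s1 := hasSum_sq_hermiteCoeff (weakDeriv u)
  have s2 := (hasSum_sq_integral hx).mul_left (1 / 4)
  have s3 := hasSum_sq_hermiteCoeff u
  have s4 := s1.add s2
  -- Derivative and multiplication by x/2 have coefficients (A - B)/2 and (A + B)/2, so the cross
  -- terms cancel in the sum of squares.
  have e : ∀ n : ℕ, hermiteCoeff (weakDeriv u) n ^ 2
      + 1 / 4 * (∫ x, hermiteFun n x * (x * u x)) ^ 2
      = ((n + 1) * hermiteCoeff u (n + 1) ^ 2 + n * hermiteCoeff u (n - 1) ^ 2) / 2 := by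
    intro n
    have q1 : Real.sqrt ((n : ℝ) + 1) ^ 2 = n + 1 := Real.sq_sqrt (by positivity)
    have q2 : Real.sqrt (n : ℝ) ^ 2 = n := Real.sq_sqrt (by positivity)
    rw [(hasWeakDeriv_weakDeriv h1).hermiteCoeff_eq, integral_hermiteFun_mul_id (Lp.memLp u)]
    change _ + 1 / 4 * (_ * hermiteCoeff u (n + 1) + _ * hermiteCoeff u (n - 1)) ^ 2 = _
    linear_combination (hermiteCoeff u (n + 1) ^ 2 / 2) * q1 + (hermiteCoeff u (n - 1) ^ 2 / 2) * q2
  simp only [e] at s4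
  have hsum : Summable fun n : ℕ => ((n : ℝ) + 1) * hermiteCoeff u (n + 1) ^ 2 := by
    refine Summable.of_nonneg_of_le (fun n => by positivity) (fun n => ?_) (s4.summable.mul_left 2)
    have : 0 ≤ (n : ℝ) * hermiteCoeff u (n - 1) ^ 2 := by positivity
    linarith
  obtain ⟨S, hS⟩ := hsum
  have hS' : HasSum (fun n : ℕ => (n : ℝ) * hermiteCoeff u n ^ 2) S := by
    refine hasSum_of_shift (by simp) (hS.congr_fun fun n => ?_)
    push_cast
    ring
  have hT : HasSum (fun n : ℕ => (n : ℝ) * hermiteCoeff u (n - 1) ^ 2) (S + ∫ x, u x ^ 2) := by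
    refine hasSum_of_shift (by simp) ((hS'.add s3).congr_fun fun n => ?_)
    simp only [Nat.add_sub_cancel]
    push_cast
    ring
  refine ⟨S, hS', ?_⟩
  rw [s4.unique ((hS.add hT).div_const 2)]
  ring

theorem hasSum_Ec {u : L2} (h1 : MemH1 u) (h2 : MemL21 u) :
    HasSum (fun n : ℕ => (n - 1) * hermiteCoeff u n ^ 2) (Ec u) := by
  obtain ⟨S, hS, h⟩ := hasSum_energy h1 h2
  have i1 := (Lp.memLp (weakDeriv u)).integrable_sq
  have i2 := ((memLp_mul_id_of_memL21 h2).integrable_sq).const_mul (1 / 4)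
  have i3 := ((Lp.memLp u).integrable_sq).const_mul (3 / 2)
  have i4 : Integrable fun x => weakDeriv u x ^ 2 + 1 / 4 * (x * u x) ^ 2 := i1.add i2
  have e : Ec u = S - ∫ x, u x ^ 2 := by
    have e1 : Ec u = ∫ x, (weakDeriv u x ^ 2 + 1 / 4 * (x * u x) ^ 2 - 3 / 2 * u x ^ 2) := by
      unfold Ec
      congr 1
      funext x
      ring
    rw [e1, integral_sub i4 i3, integral_add i1 i2, integral_const_mul, h, integral_const_mul]
    ring
  rw [e]
  refine (hS.sub (hasSum_sq_hermiteCoeff u)).congr_fun fun n => ?_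
  ring

theorem hasSum_normSqX {u : L2} (h1 : MemH1 u) (h2 : MemL21 u) :
    HasSum (fun n : ℕ => (n + 1) * hermiteCoeff u n ^ 2) (normSqX u) := by
  obtain ⟨S, hS, h⟩ := hasSum_energy h1 h2
  have i1 := (Lp.memLp (weakDeriv u)).integrable_sq
  have i2 := ((memLp_mul_id_of_memL21 h2).integrable_sq).const_mul (1 / 4)
  have i3 := ((Lp.memLp u).integrable_sq).const_mul (1 / 2)
  have i4 : Integrable fun x => weakDeriv u x ^ 2 + 1 / 4 * (x * u x) ^ 2 := i1.add i2
  have e : normSqX u = S + ∫ x, u x ^ 2 := by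
    have e1 : normSqX u = ∫ x, (weakDeriv u x ^ 2 + 1 / 4 * (x * u x) ^ 2 + 1 / 2 * u x ^ 2) := by
      unfold normSqX
      congr 1
      funext x
      ring
    rw [e1, integral_add i4 i3, integral_add i1 i2, integral_const_mul, h, integral_const_mul]
    ring
  rw [e]
  refine (hS.add (hasSum_sq_hermiteCoeff u)).congr_fun fun n => ?_
  ring

/-- The element of `L²` with prescribed square summable Hermite coefficients. -/
theorem exists_hermiteCoeff_eq {c : ℕ → ℝ} (hc : Summable fun n => c n ^ 2) :
    ∃ u : L2, ∀ n, hermiteCoeff u n = c n := by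
  refine ⟨hermiteBasis.repr.symm ⟨c, memℓp_two_iff_real.2 hc⟩, fun n => ?_⟩
  rw [← hermiteBasis_repr, LinearIsometryEquiv.apply_symm_apply]

theorem ext_hermiteCoeff {u w : L2} (h : ∀ n, hermiteCoeff u n = hermiteCoeff w n) : u = w := by
  refine hermiteBasis.repr.injective (lp.ext (funext fun n => ?_))
  rw [hermiteBasis_repr, hermiteBasis_repr, h]

section OfSummable

variable {u : L2} (hu : Summable fun n : ℕ => n * hermiteCoeff u n ^ 2)

include hu

theorem summable_sqrt_mul_succ :
    Summable fun n : ℕ => (Real.sqrt (n + 1) * hermiteCoeff u (n + 1)) ^ 2 := by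
  refine ((summable_nat_add_iff 1).2 hu).congr fun n => ?_
  rw [mul_pow, Real.sq_sqrt (by positivity)]
  push_cast
  ring

theorem summable_sqrt_mul_self :
    Summable fun n : ℕ => (Real.sqrt (n + 1) * hermiteCoeff u n) ^ 2 := by
  refine (hu.add (hasSum_sq_hermiteCoeff u).summable).congr fun n => ?_
  rw [mul_pow, Real.sq_sqrt (by positivity)]
  ring

theorem summable_sqrt_mul_pred :
    Summable fun n : ℕ => (Real.sqrt n * hermiteCoeff u (n - 1)) ^ 2 := by
  refine (summable_nat_add_iff 1).1 ((summable_sqrt_mul_self hu).congr fun n => ?_)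
  simp

/-- The ladder formula defines a square summable candidate for the coefficients of the derivative;
Parseval and summation by parts verify the weak identity. -/
theorem memH1_of_summable : MemH1 u := by
  have hs : Summable fun n : ℕ => ((Real.sqrt (n + 1) * hermiteCoeff u (n + 1)
      - Real.sqrt n * hermiteCoeff u (n - 1)) / 2) ^ 2 := by
    refine Summable.of_nonneg_of_le (fun n => sq_nonneg _) (fun n => ?_)
      ((summable_sqrt_mul_succ hu).add (summable_sqrt_mul_pred hu))
    nlinarith [sq_nonneg (Real.sqrt (n + 1) * hermiteCoeff u (n + 1)
      + Real.sqrt n * hermiteCoeff u (n - 1)), sq_nonneg (Real.sqrt (n + 1)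
      * hermiteCoeff u (n + 1)), sq_nonneg (Real.sqrt n * hermiteCoeff u (n - 1))]
  obtain ⟨g, hg⟩ := exists_hermiteCoeff_eq hs
  refine ⟨g, fun φ hφ => ?_⟩
  have ht := (hasSum_sq_integral hφ.memLp).summable
  refine eq_of_hasSum_ladder (p := fun n => -Real.sqrt n / 2) (q := fun n => Real.sqrt n / 2)
    (c := hermiteCoeff u) (t := fun n => ∫ x, hermiteFun n x * φ x) (by simp) (by simp) ?_ ?_
    ((hasSum_hermiteCoeff_mul u hφ.deriv.memLp).congr_fun fun n => ?_)
    ((hasSum_hermiteCoeff_mul g hφ.memLp).neg.congr_fun fun n => ?_)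
  · refine ((summable_mul_of_sq (summable_sqrt_mul_succ hu) ht).mul_left (-1 / 2)).congr fun n => ?_
    push_cast
    ring
  · refine ((summable_mul_of_sq (summable_sqrt_mul_self hu)
      ((summable_nat_add_iff 1).2 ht)).mul_left (1 / 2)).congr fun n => ?_
    push_cast
    ring
  · rw [hφ.integral_hermiteFun_mul_deriv]
    push_cast
    ring
  · rw [hg]
    push_cast
    ring

theorem memL21_of_summable : MemL21 u := by
  have hs : Summable fun n : ℕ => (Real.sqrt (n + 1) * hermiteCoeff u (n + 1)
      + Real.sqrt n * hermiteCoeff u (n - 1)) ^ 2 := by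
    refine Summable.of_nonneg_of_le (fun n => sq_nonneg _) (fun n => ?_)
      (((summable_sqrt_mul_succ hu).add (summable_sqrt_mul_pred hu)).mul_left 2)
    nlinarith [sq_nonneg (Real.sqrt (n + 1) * hermiteCoeff u (n + 1)
      - Real.sqrt n * hermiteCoeff u (n - 1))]
  obtain ⟨w, hw⟩ := exists_hermiteCoeff_eq hs
  have hloc : LocallyIntegrable (fun x => x * u x) :=
    ((Lp.memLp u).locallyIntegrable (by norm_num)).continuous_mul continuous_id
  -- A priori x·u is only locally integrable, so it is identified with the L² candidate by testing
  -- against compactly supported functions.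
  have key : ∀ᵐ x, x * u x = w x := by
    refine ae_eq_of_integral_contDiff_smul_eq hloc ((Lp.memLp w).locallyIntegrable (by norm_num))
      fun φ hφ1 hφ2 => ?_
    have hφ : IsTest φ := ⟨hφ1, hφ2⟩
    have hxφ : MemLp (fun x => x * φ x) 2 volume := (hφ.mul_left contDiff_id).memLp
    have ht := (hasSum_sq_integral hφ.memLp).summable
    have h := eq_of_hasSum_ladder (p := fun n => Real.sqrt n) (q := fun n => Real.sqrt n)
      (c := hermiteCoeff u) (t := fun n => ∫ x, hermiteFun n x * φ x) (by simp) (by simp)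
      ((summable_mul_of_sq (summable_sqrt_mul_succ hu) ht).congr fun n => by push_cast; rfl)
      ((summable_mul_of_sq (summable_sqrt_mul_self hu)
        ((summable_nat_add_iff 1).2 ht)).congr fun n => by push_cast; rfl)
      ((hasSum_hermiteCoeff_mul u hxφ).congr_fun fun n => by
        rw [integral_hermiteFun_mul_id hφ.memLp]; push_cast; ring)
      ((hasSum_hermiteCoeff_mul w hφ.memLp).congr_fun fun n => by
        rw [hw]; push_cast; ring)
    convert h using 2
    · funext x; simp only [smul_eq_mul]; ring
    · funext x; simp only [smul_eq_mul]; ring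
  exact memL21_of_memLp_mul_id ((Lp.memLp w).ae_eq (key.mono fun x hx => hx.symm))

theorem isDxL_of_hermiteCoeff {w : L2}
    (hw : ∀ n : ℕ, hermiteCoeff w n = (n * Real.sqrt (n + 1) * hermiteCoeff u (n + 1)
      - (n - 2) * Real.sqrt n * hermiteCoeff u (n - 1)) / 2) : IsDxL u w := by
  intro φ hφ
  have ht := (hasSum_sq_integral hφ.memLp).summable
  -- The coefficients of Lφ are n - 1 times those of φ. This extra decay of the test function makes
  -- the third-order pairing absolutely convergent for u only in the energy space.
  have ht' := (hasSum_sq_integral hφ.schrodinger.memLp).summable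
  simp only [hφ.integral_hermiteFun_mul_schrodinger] at ht'
  have ht2 : Summable fun n : ℕ => ((n : ℝ) * ∫ x, hermiteFun n x * φ x) ^ 2 := by
    refine Summable.of_nonneg_of_le (fun n => sq_nonneg _) (fun n => ?_)
      ((ht'.add ht).mul_left 2)
    nlinarith [sq_nonneg (((n : ℝ) - 1) * (∫ x, hermiteFun n x * φ x)
      - ∫ x, hermiteFun n x * φ x)]
  have ht3 : Summable fun n : ℕ => (((n : ℝ) - 1) * ∫ x, hermiteFun (n + 1) x * φ x) ^ 2 := by
    refine Summable.of_nonneg_of_le (fun n => sq_nonneg _) (fun n => ?_)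
      ((((summable_nat_add_iff 1).2 ht').add ((summable_nat_add_iff 1).2 ht)).mul_left 2)
    push_cast
    nlinarith [sq_nonneg (((n : ℝ) + 1) * (∫ x, hermiteFun (n + 1) x * φ x))]
  rw [eq_neg_iff_add_eq_zero, add_comm, ← eq_neg_iff_add_eq_zero]
  refine eq_of_hasSum_ladder (p := fun n => -((n - 1) * Real.sqrt n) / 2)
    (q := fun n => (n - 2) * Real.sqrt n / 2)
    (c := hermiteCoeff u) (t := fun n => ∫ x, hermiteFun n x * φ x) (by simp) (by simp) ?_ ?_
    ((hasSum_hermiteCoeff_mul u hφ.deriv.schrodinger.memLp).congr_fun fun n => ?_)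
    ((hasSum_hermiteCoeff_mul w hφ.memLp).neg.congr_fun fun n => ?_)
  · refine ((summable_mul_of_sq (summable_sqrt_mul_succ hu) ht2).mul_left (-1 / 2)).congr
      fun n => ?_
    push_cast
    ring
  · refine ((summable_mul_of_sq (summable_sqrt_mul_self hu) ht3).mul_left (1 / 2)).congr fun n => ?_
    push_cast
    ring
  · rw [hφ.deriv.integral_hermiteFun_mul_schrodinger, hφ.integral_hermiteFun_mul_deriv]
    push_cast
    ring
  · rw [hw]
    push_cast
    ring

end OfSummable

theorem integral_V_mul_eq_zero_iff (u : L2) : ∫ x, V x * u x = 0 ↔ hermiteCoeff u 0 = 0 := by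
  have h : ∀ x, V x = Real.exp (1 / 2)
      * Real.sqrt ((0 : ℕ).factorial * Real.sqrt (2 * Real.pi)) * hermiteFun 0 x := fun x => by
    have h1 : (1 : ℝ) / 2 - x ^ 2 / 4 = 1 / 2 + -(x ^ 2) / 4 := by ring
    have h2 := hermiteFun_norm_pos 0
    rw [V, h1, Real.exp_add, hermiteFun, Polynomial.hermite_zero, map_one, map_one, one_mul]
    field_simp
  simp only [h, mul_assoc]
  rw [integral_const_mul, integral_const_mul]
  have h2 := hermiteFun_norm_pos 0
  rw [mul_eq_zero_iff_left (Real.exp_pos (1 / 2)).ne', mul_eq_zero_iff_left h2.ne', hermiteCoeff]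

theorem mem_Xc_iff {u : L2} : u ∈ Xc ↔
    (Summable fun n : ℕ => n * hermiteCoeff u n ^ 2) ∧ hermiteCoeff u 0 = 0 := by
  constructor
  · rintro ⟨h1, h2, h3⟩
    obtain ⟨S, hS, -⟩ := hasSum_energy h1 h2
    exact ⟨hS.summable, (integral_V_mul_eq_zero_iff u).1 h3⟩
  · rintro ⟨h1, h2⟩
    exact ⟨memH1_of_summable h1, memL21_of_summable h1, (integral_V_mul_eq_zero_iff u).2 h2⟩

theorem isDxL_iff {u w : L2} (hu : u ∈ Xc) : IsDxL u w ↔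
    ∀ n : ℕ, hermiteCoeff w n = (n * Real.sqrt (n + 1) * hermiteCoeff u (n + 1)
      - (n - 2) * Real.sqrt n * hermiteCoeff u (n - 1)) / 2 :=
  ⟨fun h n => h.hermiteCoeff_eq n, fun h => isDxL_of_hermiteCoeff (mem_Xc_iff.1 hu).1 h⟩

end EnergySpace

/-! ### Reduction to the Jacobi flow, existence and uniqueness -/

section Evolution

theorem hermiteCoeff_sub (u w : L2) (n : ℕ) :
    hermiteCoeff (u - w) n = hermiteCoeff u n - hermiteCoeff w n := by
  simp only [hermiteCoeff_eq_inner, inner_sub_right]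

theorem aSeq_sub (u w : L2) (n : ℕ) : aSeq (u - w) n = aSeq u n - aSeq w n := by
  simp only [aSeq, hermiteCoeff_sub, mul_sub]

theorem aSeq_zero (u : L2) : aSeq u 0 = 0 := by simp [aSeq]

theorem aSeq_sq (u : L2) (n : ℕ) : aSeq u n ^ 2 = n * hermiteCoeff u (n + 1) ^ 2 := by
  rw [aSeq, mul_pow, Real.sq_sqrt (Nat.cast_nonneg n)]

/-- After the index shift the weights n + 1 and n differ by a plain square sum, which is finite for
every u in L². -/
theorem mem_Xc_iff_aSeq {u : L2} : u ∈ Xc ↔ Memℓp (aSeq u) 2 ∧ hermiteCoeff u 0 = 0 := by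
  rw [mem_Xc_iff, memℓp_two_iff_real]
  simp only [aSeq_sq]
  refine and_congr_left fun _ => ?_
  have h1 := (summable_nat_add_iff (f := fun n => hermiteCoeff u n ^ 2) 1).2
    (hasSum_sq_hermiteCoeff u).summable
  rw [← summable_nat_add_iff 1]
  push_cast
  constructor
  · intro h
    exact (h.sub h1).congr fun n => by ring
  · intro h
    exact (h.add h1).congr fun n => by ring

open Classical in
/-- The sequence `a_n = √n c_{n+1}` of `u` as an element of `ℓ²`. -/
noncomputable def toSeq (u : L2) : Seq2 := if h : Memℓp (aSeq u) 2 then ⟨aSeq u, h⟩ else 0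

theorem toSeq_apply {u : L2} (hu : u ∈ Xc) (n : ℕ) : toSeq u n = aSeq u n := by
  rw [toSeq, dif_pos (mem_Xc_iff_aSeq.1 hu).1]

theorem sub_mem_Xc {u w : L2} (hu : u ∈ Xc) (hw : w ∈ Xc) : u - w ∈ Xc := by
  rw [mem_Xc_iff_aSeq] at *
  refine ⟨?_, by rw [hermiteCoeff_sub, hu.2, hw.2, sub_zero]⟩
  have h : aSeq (u - w) = aSeq u - aSeq w := funext fun n => aSeq_sub u w n
  rw [h]
  exact hu.1.sub hw.1

theorem toSeq_sub {u w : L2} (hu : u ∈ Xc) (hw : w ∈ Xc) : toSeq (u - w) = toSeq u - toSeq w :=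
  lp.ext (funext fun n => by
    rw [toSeq_apply (sub_mem_Xc hu hw), aSeq_sub, lp.coeFn_sub, Pi.sub_apply, toSeq_apply hu,
      toSeq_apply hw])

theorem hermiteCoeff_two {u : L2} (hu : u ∈ Xc) : hermiteCoeff u 2 = toSeq u 1 := by
  rw [toSeq_apply hu, aSeq]
  simp

theorem Xc_ext {u w : L2} (hu : u ∈ Xc) (hw : w ∈ Xc) (h : toSeq u = toSeq w)
    (h1 : hermiteCoeff u 1 = hermiteCoeff w 1) : u = w := by
  refine ext_hermiteCoeff fun n => ?_
  match n with
  | 0 => rw [(mem_Xc_iff.1 hu).2, (mem_Xc_iff.1 hw).2]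
  | 1 => exact h1
  | n + 2 =>
    have h2 : aSeq u (n + 1) = aSeq w (n + 1) := by rw [← toSeq_apply hu, h, toSeq_apply hw]
    have h3 : Real.sqrt ((n + 1 : ℕ) : ℝ) ≠ 0 := by positivity
    exact mul_left_cancel₀ h3 h2

theorem hasSum_toSeq_sq {u : L2} (hu : u ∈ Xc) :
    HasSum (fun n : ℕ => n * hermiteCoeff u (n + 1) ^ 2) (‖toSeq u‖ ^ 2) := by
  have h := Seq2.hasSum_inner (toSeq u) (toSeq u)
  rw [real_inner_self_eq_norm_sq] at h
  refine h.congr_fun fun n => ?_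
  rw [toSeq_apply hu, ← sq, aSeq_sq]

/-- The only negative mode n = 0 is removed by the constraint, and the mode n = 1 has weight zero.
-/
theorem Ec_eq_norm_sq {u : L2} (hu : u ∈ Xc) : Ec u = ‖toSeq u‖ ^ 2 := by
  refine (hasSum_Ec hu.1 hu.2.1).unique (hasSum_of_shift ?_ ?_)
  · simp [(mem_Xc_iff.1 hu).2]
  · refine (hasSum_toSeq_sq hu).congr_fun fun n => ?_
    push_cast
    ring

theorem norm_toSeq_sq_le {u : L2} (hu : u ∈ Xc) : ‖toSeq u‖ ^ 2 ≤ normSqX u := by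
  rw [← Ec_eq_norm_sq hu]
  refine hasSum_le (fun n => ?_) (hasSum_Ec hu.1 hu.2.1) (hasSum_normSqX hu.1 hu.2.1)
  nlinarith [sq_nonneg (hermiteCoeff u n)]

theorem norm_sq_le {u : L2} (hu : u ∈ Xc) : ‖u‖ ^ 2 ≤ normSqX u := by
  have h : ‖u‖ ^ 2 = ∫ x, u x ^ 2 := by
    rw [← real_inner_self_eq_norm_sq, inner_eq_integral]
    simp only [sq]
  rw [h]
  refine hasSum_le (fun n => ?_) (hasSum_sq_hermiteCoeff u) (hasSum_normSqX hu.1 hu.2.1)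
  nlinarith [sq_nonneg (hermiteCoeff u n), mul_nonneg (Nat.cast_nonneg (α := ℝ) n)
    (sq_nonneg (hermiteCoeff u n))]

theorem normSqX_nonneg {u : L2} (hu : u ∈ Xc) : 0 ≤ normSqX u :=
  (sq_nonneg _).trans (norm_sq_le hu)

/-- Since n + 1 ≤ 3(n - 1) for n ≥ 2, the energy controls every mode but c_1. Continuity in X_c thus
reduces to continuity of c_1 and of the ℓ² sequence. -/
theorem normSqX_le {u : L2} (hu : u ∈ Xc) :
    normSqX u ≤ 2 * hermiteCoeff u 1 ^ 2 + 3 * ‖toSeq u‖ ^ 2 := by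
  have h1 : HasSum (fun n : ℕ => if n = 1 then 2 * hermiteCoeff u 1 ^ 2 else 0)
      (2 * hermiteCoeff u 1 ^ 2) := hasSum_ite_eq 1 _
  have h2 : HasSum (fun n : ℕ => if n = 0 then 0 else ((n : ℝ) - 1) * hermiteCoeff u n ^ 2)
      (‖toSeq u‖ ^ 2) := by
    refine hasSum_of_shift (by simp) ((hasSum_toSeq_sq hu).congr_fun fun n => ?_)
    simp
  refine hasSum_le (fun n => ?_) (hasSum_normSqX hu.1 hu.2.1) (h1.add (h2.mul_left 3))
  match n with
  | 0 => simp [(mem_Xc_iff.1 hu).2]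
  | 1 => norm_num
  | n + 2 =>
    simp only [Nat.add_eq_zero_iff, OfNat.ofNat_ne_zero, and_false, if_false, zero_add,
      show n + 2 ≠ 1 by omega]
    push_cast
    nlinarith [mul_nonneg (Nat.cast_nonneg (α := ℝ) n) (sq_nonneg (hermiteCoeff u (n + 2)))]

theorem sqrt_mul_dxL_eq_skewJacobi (u : L2) (k : ℕ) :
    Real.sqrt (k + 1) * (((k + 2) * Real.sqrt (k + 3) * hermiteCoeff u (k + 3)
      - k * Real.sqrt (k + 2) * hermiteCoeff u (k + 1)) / 2) = skewJacobi (aSeq u) (k + 1) := by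
  have h1 : jacobiCoeff (k + 1)
      = Real.sqrt (k + 1) * Real.sqrt (k + 2) * Real.sqrt (k + 3) := by
    rw [← Real.sqrt_mul (by positivity), ← Real.sqrt_mul (by positivity), jacobiCoeff]
    push_cast
    congr 1
    ring
  have h2 : jacobiCoeff k = Real.sqrt k * Real.sqrt (k + 1) * Real.sqrt (k + 2) := by
    rw [← Real.sqrt_mul (by positivity), ← Real.sqrt_mul (by positivity), jacobiCoeff]
  have q1 : Real.sqrt ((k : ℝ) + 2) ^ 2 = k + 2 := Real.sq_sqrt (by positivity)
  have q2 : Real.sqrt (k : ℝ) ^ 2 = k := Real.sq_sqrt (by positivity)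
  simp only [skewJacobi, aSeq, h1, h2]
  push_cast
  linear_combination (-(Real.sqrt (k + 1) * Real.sqrt (k + 3) * hermiteCoeff u (k + 3)) / 2) * q1
    + (Real.sqrt (k + 1) * Real.sqrt (k + 2) * hermiteCoeff u (k + 1) / 2) * q2

/-- Rows n ≥ 2 of ∂ₓL, rescaled by √(n-1), form the skew Jacobi matrix; row 1 gives the equation for
c_1. -/
theorem isGen_iff {u w : L2} (hu : u ∈ Xc) (hw : w ∈ Xc) : IsGen u w ↔
    (toSeq u, toSeq w) ∈ jacobiRel ∧
      hermiteCoeff w 1 = Real.sqrt 2 / 2 * hermiteCoeff u 2 := by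
  have hu0 := (mem_Xc_iff.1 hu).2
  have hw0 := (mem_Xc_iff.1 hw).2
  have hcoe : ((toSeq u : Seq2) : ℕ → ℝ) = aSeq u := funext (toSeq_apply hu)
  have hrel : IsDxL u w ↔ (∀ n, aSeq w n = skewJacobi (aSeq u) n) ∧
      hermiteCoeff w 1 = Real.sqrt 2 / 2 * hermiteCoeff u 2 := by
    rw [isDxL_iff hu]
    constructor
    · intro h
      refine ⟨fun n => ?_, ?_⟩
      · cases n with
        | zero => rw [aSeq_zero]; rfl
        | succ k =>
          rw [← sqrt_mul_dxL_eq_skewJacobi, aSeq, h]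
          have e1 : ((k + 1 + 1 : ℕ) : ℝ) = k + 2 := by push_cast; ring
          have e2 : (k : ℝ) + 2 + 1 = k + 3 := by ring
          rw [e1, e2]
          push_cast
          simp only [add_sub_cancel_right]
      · rw [h, Nat.sub_self, hu0]
        norm_num
        ring
    · rintro ⟨h1, h2⟩ n
      match n with
      -- Row 0 of ∂ₓL vanishes identically: the range is automatically orthogonal to V.
      | 0 => simp [hw0]
      | 1 =>
        rw [h2, Nat.sub_self, hu0]
        norm_num
        ring
      | k + 2 =>
        have h3 : Real.sqrt ((k : ℝ) + 1) ≠ 0 := by positivity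
        refine mul_left_cancel₀ h3 ?_
        have h4 := h1 (k + 1)
        rw [← sqrt_mul_dxL_eq_skewJacobi, aSeq] at h4
        have e1 : ((k + 2 : ℕ) : ℝ) = k + 2 := by push_cast; ring
        have e2 : (k : ℝ) + 2 + 1 = k + 3 := by ring
        rw [e1, e2]
        push_cast at h4
        simp only [add_sub_cancel_right]
        exact h4
  have hdom : fSeq u ∈ jacobiDomain ↔ _ := mem_jacobiDomain_iff (aSeq u)
  rw [mem_jacobiRel]
  simp only [hcoe, toSeq_apply hw]
  constructor
  · rintro ⟨-, -, h3, h4⟩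
    exact ⟨⟨(hrel.1 h3).1, (hdom.1 h4).2.2⟩, (hrel.1 h3).2⟩
  · rintro ⟨⟨h1, h2⟩, h3⟩
    refine ⟨hu, hw, hrel.2 ⟨h1, h3⟩, hdom.2 ⟨(mem_Xc_iff_aSeq.1 hu).1, ?_, h2⟩⟩
    have h4 : skewJacobi (aSeq u) = aSeq w := funext fun n => (h1 n).symm
    rw [h4]
    exact (mem_Xc_iff_aSeq.1 hw).1

theorem hermiteCoeff_integral {w : ℝ → L2} {t : ℝ} (hw : IntervalIntegrable w volume 0 t)
    (n : ℕ) : hermiteCoeff (∫ s in (0 : ℝ)..t, w s) n = ∫ s in (0 : ℝ)..t, hermiteCoeff (w s) n := by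
  simp only [hermiteCoeff_eq_inner]
  exact (ContinuousLinearMap.intervalIntegral_comp_comm (innerSL ℝ (hermiteLp n)) hw).symm

theorem Seq2.integral_apply {b : ℝ → Seq2} {t : ℝ} (hb : IntervalIntegrable b volume 0 t)
    (n : ℕ) : (∫ s in (0 : ℝ)..t, b s : Seq2) n = ∫ s in (0 : ℝ)..t, b s n := by
  have h : ∀ x : Seq2, x n = innerSL ℝ (lp.single 2 n (1 : ℝ) : Seq2) x := fun x => by
    rw [innerSL_apply_apply, lp.inner_single_left]
    simp
  simp only [h]
  exact (ContinuousLinearMap.intervalIntegral_comp_comm _ hb).symm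

theorem integral_mem_Xc {w : ℝ → L2} {t : ℝ} (ht : 0 ≤ t) (hmem : ∀ s, 0 ≤ s → w s ∈ Xc)
    (hw : IntervalIntegrable w volume 0 t)
    (hb : IntervalIntegrable (fun s => toSeq (w s)) volume 0 t) :
    (∫ s in (0 : ℝ)..t, w s) ∈ Xc ∧
      toSeq (∫ s in (0 : ℝ)..t, w s) = ∫ s in (0 : ℝ)..t, toSeq (w s) := by
  have h1 : ∀ n, aSeq (∫ s in (0 : ℝ)..t, w s) n = (∫ s in (0 : ℝ)..t, toSeq (w s) : Seq2) n := by
    intro n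
    rw [aSeq, hermiteCoeff_integral hw, Seq2.integral_apply hb, ← intervalIntegral.integral_const_mul]
    refine intervalIntegral.integral_congr fun s hs => ?_
    rw [uIcc_of_le ht] at hs
    simp only
    rw [toSeq_apply (hmem s hs.1), aSeq]
  have h2 : (∫ s in (0 : ℝ)..t, w s) ∈ Xc := by
    refine mem_Xc_iff_aSeq.2 ⟨?_, ?_⟩
    · rw [funext h1]
      exact lp.memℓp _
    · have h3 : EqOn (fun s => hermiteCoeff (w s) 0) (fun _ => 0) (uIcc 0 t) := fun s hs => by
        rw [uIcc_of_le ht] at hs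
        exact (mem_Xc_iff.1 (hmem s hs.1)).2
      rw [hermiteCoeff_integral hw, intervalIntegral.integral_congr h3,
        intervalIntegral.integral_zero]
  exact ⟨h2, lp.ext (funext fun n => by rw [toSeq_apply h2, h1])⟩

/-- The integrated equation in terms of Hermite coefficients. -/
theorem isGen_integral_iff {w : ℝ → L2} {t : ℝ} (ht : 0 ≤ t) (hmem : ∀ s, 0 ≤ s → w s ∈ Xc)
    (hw : IntervalIntegrable w volume 0 t)
    (hb : IntervalIntegrable (fun s => toSeq (w s)) volume 0 t) :
    IsGen (∫ s in (0 : ℝ)..t, w s) (w t - w 0) ↔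
      (∫ s in (0 : ℝ)..t, toSeq (w s), toSeq (w t) - toSeq (w 0)) ∈ jacobiRel ∧
      hermiteCoeff (w t) 1 - hermiteCoeff (w 0) 1
        = Real.sqrt 2 / 2 * ∫ s in (0 : ℝ)..t, toSeq (w s) 1 := by
  obtain ⟨h1, h2⟩ := integral_mem_Xc ht hmem hw hb
  rw [isGen_iff h1 (sub_mem_Xc (hmem t ht) (hmem 0 le_rfl)), h2,
    toSeq_sub (hmem t ht) (hmem 0 le_rfl), hermiteCoeff_sub, hermiteCoeff_two h1, h2,
    Seq2.integral_apply hb]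

theorem continuousOn_of_norm_sq_le {E : Type*} [NormedAddCommGroup E] {w : ℝ → L2} {F : ℝ → E}
    (hF : ∀ t, 0 ≤ t → ∀ s, 0 ≤ s → ‖F t - F s‖ ^ 2 ≤ normSqX (w t - w s))
    (hc : ∀ s, 0 ≤ s → Tendsto (fun t => normSqX (w t - w s)) (𝓝[Ici 0] s) (𝓝 0)) :
    ContinuousOn F (Ici 0) := by
  intro s hs
  rw [ContinuousWithinAt, tendsto_iff_norm_sub_tendsto_zero]
  have h : Tendsto (fun t => ‖F t - F s‖ ^ 2) (𝓝[Ici 0] s) (𝓝 0) := by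
    refine tendsto_of_tendsto_of_tendsto_of_le_of_le' tendsto_const_nhds (hc s hs)
      (Eventually.of_forall fun t => sq_nonneg _) ?_
    filter_upwards [self_mem_nhdsWithin] with t ht
    exact hF t ht s hs
  have h2 := h.sqrt
  simpa [Real.sqrt_sq] using h2

theorem IsSolution.continuousOn {w : ℝ → L2} (hw : IsSolution w) : ContinuousOn w (Ici 0) :=
  continuousOn_of_norm_sq_le
    (fun t ht s hs => norm_sq_le (sub_mem_Xc (hw.mem t ht) (hw.mem s hs))) hw.continuous

theorem IsSolution.continuousOn_toSeq {w : ℝ → L2} (hw : IsSolution w) :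
    ContinuousOn (fun t => toSeq (w t)) (Ici 0) :=
  continuousOn_of_norm_sq_le (fun t ht s hs => by
    rw [← toSeq_sub (hw.mem t ht) (hw.mem s hs)]
    exact norm_toSeq_sq_le (sub_mem_Xc (hw.mem t ht) (hw.mem s hs))) hw.continuous

theorem intervalIntegrable_of_continuousOn_Ici {E : Type*} [NormedAddCommGroup E] {F : ℝ → E}
    (hF : ContinuousOn F (Ici 0)) {t : ℝ} (ht : 0 ≤ t) : IntervalIntegrable F volume 0 t :=
  (hF.mono (by rw [uIcc_of_le ht]; exact Icc_subset_Ici_self)).intervalIntegrable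

theorem IsSolution.toSeq_equation {w : ℝ → L2} (hw : IsSolution w) {t : ℝ} (ht : 0 ≤ t) :
    (∫ s in (0 : ℝ)..t, toSeq (w s), toSeq (w t) - toSeq (w 0)) ∈ jacobiRel ∧
      hermiteCoeff (w t) 1 - hermiteCoeff (w 0) 1
        = Real.sqrt 2 / 2 * ∫ s in (0 : ℝ)..t, toSeq (w s) 1 :=
  (isGen_integral_iff ht hw.mem (intervalIntegrable_of_continuousOn_Ici hw.continuousOn ht)
    (intervalIntegrable_of_continuousOn_Ici hw.continuousOn_toSeq ht)).1 (hw.equation t ht)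

theorem hasDerivWithinAt_integral {F : ℝ → Seq2} (hF : ContinuousOn F (Ici 0)) {t T : ℝ}
    (ht : t ∈ Icc 0 T) :
    HasDerivWithinAt (fun t => ∫ s in (0 : ℝ)..t, F s) (F t) (Icc 0 T) t := by
  -- F is controlled only on [0, ∞); freezing it at F(0) for negative times gives a continuous
  -- function on ℝ with the same integrals.
  have hc : Continuous fun s => F (max s 0) :=
    hF.comp_continuous (by fun_prop) fun s => le_max_right s 0
  have h := (hc.integral_hasStrictDerivAt 0 t).hasDerivAt.hasDerivWithinAt (s := Icc 0 T)
  rw [max_eq_left ht.1] at h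
  have e : ∀ r ∈ Icc 0 T, ∫ s in (0 : ℝ)..r, F s = ∫ s in (0 : ℝ)..r, F (max s 0) := by
    intro r hr
    refine intervalIntegral.integral_congr fun s hs => ?_
    rw [uIcc_of_le hr.1] at hs
    simp only [max_eq_left hs.1]
  exact h.congr e (e t ht)

/-- A mild solution need not be differentiable, but its time integral is. The difference of the
integrals solves the Jacobi equation from 0 and vanishes; then so does its image under A, the
difference of the sequences. -/
theorem IsSolution.eq {u w : ℝ → L2} (hu : IsSolution u) (hw : IsSolution w) (h0 : w 0 = u 0)
    {t : ℝ} (ht : 0 ≤ t) : w t = u t := by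
  have hzero := isSkewAdjoint_jacobiRel.eq_zero_of_hasDerivWithinAt
    (z := fun t => (∫ s in (0 : ℝ)..t, toSeq (w s)) - ∫ s in (0 : ℝ)..t, toSeq (u s))
    (z' := fun t => toSeq (w t) - toSeq (u t)) (T := t)
    (fun s hs => (hasDerivWithinAt_integral hw.continuousOn_toSeq hs).sub
      (hasDerivWithinAt_integral hu.continuousOn_toSeq hs))
  have hmem : ∀ s, 0 ≤ s → ((∫ r in (0 : ℝ)..s, toSeq (w r)) - ∫ r in (0 : ℝ)..s, toSeq (u r),
      toSeq (w s) - toSeq (u s)) ∈ jacobiRel := by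
    intro s hs
    have h := jacobiRel.sub_mem (hw.toSeq_equation hs).1 (hu.toSeq_equation hs).1
    rw [h0, Prod.mk_sub_mk, sub_sub_sub_cancel_right] at h
    exact h
  have hseq : ∀ s ∈ Icc 0 t, toSeq (w s) = toSeq (u s) := by
    intro s hs
    have h1 := hzero (fun r hr => hmem r hr.1) (by simp) s hs
    have h2 := hmem s hs.1
    rw [h1] at h2
    refine sub_eq_zero.1 (lp.ext (funext fun n => ?_))
    rw [(mem_jacobiRel.1 h2).1 n]
    cases n <;> simp [skewJacobi]
  refine Xc_ext (hw.mem t ht) (hu.mem t ht) (hseq t (right_mem_Icc.2 ht)) ?_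
  have e1 := (hw.toSeq_equation ht).2
  have e2 := (hu.toSeq_equation ht).2
  have e3 : ∫ s in (0 : ℝ)..t, toSeq (w s) 1 = ∫ s in (0 : ℝ)..t, toSeq (u s) 1 := by
    refine intervalIntegral.integral_congr fun s hs => ?_
    rw [uIcc_of_le ht] at hs
    simp only [hseq s hs]
  rw [h0, e3, ← e2] at e1
  linarith

/-- An element of the energy space is determined by its coefficient at `u_1` and an arbitrary
square summable sequence. -/
theorem exists_mem_Xc (c : ℝ) (x : Seq2) (hx : x 0 = 0) :
    ∃ u ∈ Xc, hermiteCoeff u 1 = c ∧ toSeq u = x := by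
  let d : ℕ → ℝ := fun n => match n with
    | 0 => 0
    | 1 => c
    | n + 2 => x (n + 1) / Real.sqrt (n + 1)
  have hx2 : Summable fun n => x n ^ 2 := memℓp_two_iff_real.1 (lp.memℓp x)
  have hd : Summable fun n => d n ^ 2 := by
    refine (summable_nat_add_iff 2).1 (Summable.of_nonneg_of_le (fun n => sq_nonneg _)
      (fun n => ?_) ((summable_nat_add_iff 1).2 hx2))
    change (x (n + 1) / Real.sqrt (n + 1)) ^ 2 ≤ x (n + 1) ^ 2
    rw [div_pow, Real.sq_sqrt (by positivity)]
    exact div_le_self (sq_nonneg _) (by linarith [(Nat.cast_nonneg n : (0 : ℝ) ≤ n)])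
  obtain ⟨u, hu⟩ := exists_hermiteCoeff_eq hd
  have ha : ∀ n, aSeq u n = x n := fun n => by
    cases n with
    | zero => rw [aSeq_zero, hx]
    | succ n =>
      have h : Real.sqrt ((n : ℝ) + 1) ≠ 0 := by positivity
      rw [aSeq, hu]
      change Real.sqrt ((n + 1 : ℕ) : ℝ) * (x (n + 1) / Real.sqrt (n + 1)) = _
      push_cast
      field_simp
  have hmem : u ∈ Xc := by
    refine mem_Xc_iff_aSeq.2 ⟨?_, hu 0⟩
    rw [funext ha]
    exact lp.memℓp x
  exact ⟨u, hmem, hu 1, lp.ext (funext fun n => by rw [toSeq_apply hmem, ha])⟩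

/-- The isometric Jacobi flow supplies the sequence at each time, c_1 is obtained by integrating
(√2/2) a_1, and the two together determine an element of X_c. -/
theorem exists_isSolution {u₀ : L2} (hu₀ : u₀ ∈ Xc) :
    ∃ u : ℝ → L2, IsSolution u ∧ u 0 = u₀ ∧ ∀ t, 0 ≤ t → Ec (u t) = Ec u₀ := by
  obtain ⟨a, hac, ha0, han, haG⟩ :=
    isSkewAdjoint_jacobiRel.exists_flow dense_domain_jacobiRel (toSeq u₀)
  -- The entry at 0 is a dummy in ℓ²; row 0 of the matrix is zero, so the flow preserves its
  -- vanishing, as reconstruction in X_c requires.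
  have ha00 : ∀ t, a t 0 = 0 := by
    intro t
    have h := (mem_jacobiRel.1 (haG t)).1 0
    simp only [lp.coeFn_sub, Pi.sub_apply, toSeq_apply hu₀, aSeq_zero, sub_zero] at h
    rw [h, skewJacobi]
  choose u hu hu1 hus using fun t => exists_mem_Xc
    (hermiteCoeff u₀ 1 + Real.sqrt 2 / 2 * ∫ s in (0 : ℝ)..t, a s 1) (a t) (ha00 t)
  have ha1 : Continuous fun s => a s 1 := by
    have h : ∀ x : Seq2, x 1 = innerSL ℝ (lp.single 2 1 (1 : ℝ) : Seq2) x := fun x => by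
      rw [innerSL_apply_apply, lp.inner_single_left]
      simp
    simp only [h]
    fun_prop
  have hi1 : Continuous fun t => ∫ s in (0 : ℝ)..t, a s 1 :=
    intervalIntegral.continuous_primitive (fun _ _ => ha1.intervalIntegrable _ _) 0
  have hu1c : Continuous fun t => hermiteCoeff (u t) 1 := by
    simp only [hu1]
    fun_prop
  have huc : ∀ s, Tendsto (fun t => normSqX (u t - u s)) (𝓝 s) (𝓝 0) := by
    intro s
    have h1 : Tendsto (fun t => 2 * (hermiteCoeff (u t) 1 - hermiteCoeff (u s) 1) ^ 2
        + 3 * ‖a t - a s‖ ^ 2) (𝓝 s) (𝓝 0) := by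
      have h : Continuous fun t => 2 * (hermiteCoeff (u t) 1 - hermiteCoeff (u s) 1) ^ 2
        + 3 * ‖a t - a s‖ ^ 2 := by fun_prop
      simpa using h.tendsto s
    refine tendsto_of_tendsto_of_tendsto_of_le_of_le tendsto_const_nhds h1
      (fun t => normSqX_nonneg (sub_mem_Xc (hu t) (hu s))) fun t => ?_
    have h := normSqX_le (sub_mem_Xc (hu t) (hu s))
    rwa [toSeq_sub (hu t) (hu s), hus, hus, hermiteCoeff_sub] at h
  have huc' : ∀ s, 0 ≤ s → Tendsto (fun t => normSqX (u t - u s)) (𝓝[Ici 0] s) (𝓝 0) :=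
    fun s _ => (huc s).mono_left nhdsWithin_le_nhds
  have hu0 : u 0 = u₀ := by
    refine Xc_ext (hu 0) hu₀ (by rw [hus, ha0]) ?_
    rw [hu1]
    simp
  have hcon : ContinuousOn u (Ici 0) := continuousOn_of_norm_sq_le
    (fun t _ s _ => norm_sq_le (sub_mem_Xc (hu t) (hu s))) huc'
  refine ⟨u, ⟨fun t _ => hu t, huc', fun t ht => ?_⟩, hu0, fun t _ => ?_⟩
  · refine (isGen_integral_iff ht (fun s _ => hu s)
      (intervalIntegrable_of_continuousOn_Ici hcon ht) ?_).2 ⟨?_, ?_⟩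
    · simp only [hus]
      exact hac.intervalIntegrable _ _
    · simp only [hus, ha0]
      exact haG t
    · simp only [hus, hu1, intervalIntegral.integral_same]
      ring
  · rw [Ec_eq_norm_sq (hu t), Ec_eq_norm_sq hu₀, hus, han]

end Evolution

end LogKdV

theorem mainTheorem5 (u₀ : LogKdV.L2) (hu₀ : u₀ ∈ LogKdV.Xc) :
    ∃ u : ℝ → LogKdV.L2,
      LogKdV.IsSolution u ∧ u 0 = u₀ ∧
      (∀ t, 0 ≤ t → LogKdV.Ec (u t) = LogKdV.Ec u₀) ∧
      ∀ w : ℝ → LogKdV.L2, LogKdV.IsSolution w → w 0 = u₀ → ∀ t, 0 ≤ t → w t = u t := by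
  obtain ⟨u, hu, hu0, hE⟩ := LogKdV.exists_isSolution hu₀
  exact ⟨u, hu, hu0, hE, fun w hw hw0 t ht => hu.eq hw (hw0.trans hu0.symm) ht⟩
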